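/- **Setting.** There are $K$ studies and a sequence of i.i.d. individuals, each with covariates $X\in\mathbb R^d$, treatment $W\in\{0,1\}$, study $H\in\{1,\dots,K\}$, potential outcomes $Y(0),Y(1)$ and observed outcome $Y=Y(W)$. The setting is homogeneous and randomized within studies: $(X,Y(0),Y(1))$ is independent of $(H,W)$, while $p_k=\mathbb P(W=1\mid H=k)\in(0,1)$ may depend on $k$. Put $\rho_k=\mathbb P(H=k)>0$ and $p=\mathbb P(W=1)=\sum_k\rho_kp_k$. Outcomes are linear, $Y(w)=c^{(w)}+X\beta^{(w)}+\varepsilon(w)$ with $\mathbb E(\varepsilon(w)\mid X)=0$ and $\mathbb V(\varepsilon(w)\mid X)=\sigma^2>0$; $X$ has finite second moments and a positive definite covariance matrix $\Sigma$. Let $\tau=\mathbb E(Y(1)-Y(0))$ and $\|v\|_\Sigma^2=v^\top\Sigma v$. **Estimators** (from the first $n$ individuals; $n_k$ are in study $k$, $n^{(w)}$ in arm $w$, $n_k^{(w)}$ in both; $X'=(1,X)$). For $w\in\{0,1\}$ let $\hat\theta^{(w)}_{\rm pool}$ and $\hat\theta_k^{(w)}$ be the OLS estimators of $Y$ on $X'$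 over arm $w$ of all the data, and of study $k$, respectively. Let $\hat\theta^{(w)}_{\text{1S-SW}}=\sum_k\frac{n_k^{(w)}}{n^{(w)}}\hat\theta^{(w)}_k$, let $\hat\theta^{(w)}_{\text{1S-IVW}}=\big(\sum_k G_k^{(w)}\big)^{-1}\sum_k G_k^{(w)}\hat\theta_k^{(w)}$ with $G_k^{(w)}=\sigma^{-2}X_k'^{(w)\top}X_k'^{(w)}$, and let $\hat\theta^{(w)}_{\rm GD}$ be the limit, as the number of rounds tends to infinity, of full-batch FedAvg on the mean squared error of arm $w$ (each study performs some number of local gradient steps, the results are averaged with weights $n_k^{(w)}/n^{(w)}$), with parameters chosen such that it converges to $\hat\theta^{(w)}_{\rm pool}$ whenever the pooled regression has full rank. With $\overline{X'}$ and $\overline{X'_k}$ the averages of $X'$ over all the data and over study $k$, set $$\hat\tau_{\rm pool}=\overline{X'}\big(\hat\theta^{(1)}_{\rm pool}-\hat\theta^{(0)}_{\rm pool}\big),\quad \hat\tau_k=\overline{X'_k}\big(\hat\theta^{(1)}_k-\hat\theta^{(0)}_k\big),\quad \hat\tau_{\rm fed}=\sum_k\frac{n_k}{n}\,\overline{X'_k}\big(\hat\theta^{(1)}_{\rm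 fed}-\hat\theta^{(0)}_{\rm fed}\big)$$ for $\mathrm{fed}\in\{\text{GD},\text{1S-IVW},\text{1S-SW}\}$, and $$\hat\tau_{\text{Meta-SW}}=\sum_k\frac{n_k}{n}\hat\tau_k,\qquad \hat\tau_{\text{Meta-IVW}}=\frac{\sum_k (v_k/n_k)^{-1}\hat\tau_k}{\sum_k (v_k/n_k)^{-1}},\qquad v_k=\frac{\sigma^2}{p_k(1-p_k)}+\|\beta^{(1)}-\beta^{(0)}\|_\Sigma^2 .$$ Rank-deficient regressions, whose probability tends to $0$, receive a default value. Write $V^\infty(\hat\tau)$ for the variance $V$ of the limit law in $\sqrt n(\hat\tau-\tau)\xrightarrow{d}\mathcal N(0,V)$. **Theorem.** For each $k$, $\sqrt{n_k}(\hat\tau_k-\tau)\xrightarrow{d}\mathcal N(0,v_k)$. The asymptotic variances of the other estimators exist, with values $$V^\infty(\hat\tau_{\rm pool})=V^\infty(\hat\tau_{\rm GD})=V^\infty(\hat\tau_{\text{1S-IVW}})=V^\infty(\hat\tau_{\text{1S-SW}})=\frac{\sigma^2}{p(1-p)}+\|\beta^{(1)}-\beta^{(0)}\|_\Sigma^2,$$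 $$V^\infty(\hat\tau_{\text{Meta-IVW}})=\Big(\sum_k\frac{\rho_k}{v_k}\Big)^{-1},\qquad V^\infty(\hat\tau_{\text{Meta-SW}})=\sigma^2\sum_k\frac{\rho_k}{p_k(1-p_k)}+\|\beta^{(1)}-\beta^{(0)}\|_\Sigma^2,$$ and they satisfy $$V^\infty(\hat\tau_{\rm pool})=V^\infty(\hat\tau_{\rm fed})\le V^\infty(\hat\tau_{\text{Meta-IVW}})\le V^\infty(\hat\tau_{\text{Meta-SW}}).$$ The first inequality is strict as soon as the $p_k$ are not all equal, and the second as soon as the $p_k(1-p_k)$ are not all equal. Moreover, the requirement on the FedAvg parameters is met by one local step per round and a common learning rate $0<\eta<2/L$, where $L$ is the largest eigenvalue of $\frac{2}{n^{(w)}}X'^{(w)\top}X'^{(w)}$. -/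

import Mathlib

open MeasureTheory ProbabilityTheory Filter Topology

namespace FedCausal

noncomputable section

/-! ### Datasets and estimators

Every estimator is a function of the observed dataset. Inverses are Mathlib's matrix inverse
and divisions are real divisions, so an estimator whose regressions are rank deficient gets an
arbitrary (measurable) default value. -/

/-- One observation `(X, W, H, Y)`: covariates, treatment arm, study, outcome. -/
structure Obs (K d : ℕ) where
  x : Fin d → ℝ
  w : Fin 2
  h : Fin K
  y : ℝ

/-- A dataset of `n` observations. -/
abbrev Dataset (K d n : ℕ) := Fin n → Obs K d

/-- The covariate vector with an intercept, `x' = (1, x)`. -/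
def aug {d : ℕ} (x : Fin d → ℝ) : Fin (d + 1) → ℝ := Fin.cons 1 x

section Estimators

variable {K d n : ℕ}

/-- Observations of treatment arm `w`, over all studies. -/
def arm (D : Dataset K d n) (w : Fin 2) : Finset (Fin n) :=
  Finset.univ.filter fun i => (D i).w = w

/-- Observations of study `k`, in both arms. -/
def site (D : Dataset K d n) (k : Fin K) : Finset (Fin n) :=
  Finset.univ.filter fun i => (D i).h = k

/-- Observations of study `k` in treatment arm `w`. -/
def cell (D : Dataset K d n) (k : Fin K) (w : Fin 2) : Finset (Fin n) :=
  Finset.univ.filter fun i => (D i).h = k ∧ (D i).w = w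

/-- The matrix `X'ᵀ X'` of the observations in `s`, written as a sum of rank-one matrices. -/
def gram (D : Dataset K d n) (s : Finset (Fin n)) : Matrix (Fin (d + 1)) (Fin (d + 1)) ℝ :=
  ∑ i ∈ s, Matrix.vecMulVec (aug (D i).x) (aug (D i).x)

/-- The vector `X'ᵀ Y` of the observations in `s`. -/
def crossMoment (D : Dataset K d n) (s : Finset (Fin n)) : Fin (d + 1) → ℝ :=
  ∑ i ∈ s, (D i).y • aug (D i).x

/-- The regression (with intercept) over the observations in `s` has full rank. -/
def FullRank (D : Dataset K d n) (s : Finset (Fin n)) : Prop :=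
  (gram D s).rank = d + 1

/-- The ordinary least squares estimator `(X'ᵀ X')⁻¹ X'ᵀ Y` over the observations in `s`. -/
def ols (D : Dataset K d n) (s : Finset (Fin n)) : Fin (d + 1) → ℝ :=
  (gram D s)⁻¹.mulVec (crossMoment D s)

/-- The plug-in G-formula over the observations in `s` with outcome parameters `θ 1`, `θ 0`:
the average over `s` of `X'_i θ⁽¹⁾ - X'_i θ⁽⁰⁾`. -/
def gFormula (D : Dataset K d n) (s : Finset (Fin n)) (θ : Fin 2 → Fin (d + 1) → ℝ) : ℝ :=
  (s.card : ℝ)⁻¹ * ∑ i ∈ s, (aug (D i).x ⬝ᵥ θ 1 - aug (D i).x ⬝ᵥ θ 0)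

/-- Aggregation of study-level estimates of the treatment effect by sample-size weights
`n_k / n`. -/
def swAggregate (D : Dataset K d n) (t : Fin K → ℝ) : ℝ :=
  ∑ k, ((site D k).card : ℝ) / n * t k

/-- Pooled outcome parameters. -/
def thetaPool (D : Dataset K d n) (w : Fin 2) : Fin (d + 1) → ℝ := ols D (arm D w)

/-- Local outcome parameters of study `k`. -/
def thetaLocal (D : Dataset K d n) (k : Fin K) (w : Fin 2) : Fin (d + 1) → ℝ :=
  ols D (cell D k w)

/-- One-shot outcome parameters with sample-size weights `n_k⁽ʷ⁾ / n⁽ʷ⁾`. -/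
def theta1SSW (D : Dataset K d n) (w : Fin 2) : Fin (d + 1) → ℝ :=
  ∑ k, (((cell D k w).card : ℝ) / (arm D w).card) • thetaLocal D k w

/-- One-shot outcome parameters with inverse-variance weights, where the inverse of the
variance of the local OLS estimator is `σ⁻² X'_k⁽ʷ⁾ᵀ X'_k⁽ʷ⁾`. -/
def theta1SIVW (σ : ℝ) (D : Dataset K d n) (w : Fin 2) : Fin (d + 1) → ℝ :=
  (∑ k, (σ ^ 2)⁻¹ • gram D (cell D k w))⁻¹.mulVec
    (∑ k, ((σ ^ 2)⁻¹ • gram D (cell D k w)).mulVec (thetaLocal D k w))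

/-- Pooled-data estimator of the treatment effect. -/
def tauPool (D : Dataset K d n) : ℝ := gFormula D Finset.univ (thetaPool D)

/-- Local estimator of study `k`. -/
def tauLocal (k : Fin K) (D : Dataset K d n) : ℝ := gFormula D (site D k) (thetaLocal D k)

/-- Meta-analysis with sample-size weights. -/
def tauMetaSW (D : Dataset K d n) : ℝ := swAggregate D fun k => tauLocal k D

/-- Meta-analysis with inverse-variance weights, when the variance of the local estimator of
study `k`, given its sample size `n_k`, is `v k / n_k`. -/
def tauMetaIVW (v : Fin K → ℝ) (D : Dataset K d n) : ℝ :=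
  (∑ k, (v k / ((site D k).card : ℝ))⁻¹ * tauLocal k D) /
    ∑ k, (v k / ((site D k).card : ℝ))⁻¹

/-- One-shot estimator with sample-size federation of the outcome parameters. -/
def tau1SSW (D : Dataset K d n) : ℝ :=
  swAggregate D fun k => gFormula D (site D k) (theta1SSW D)

/-- One-shot estimator with inverse-variance federation of the outcome parameters. -/
def tau1SIVW (σ : ℝ) (D : Dataset K d n) : ℝ :=
  swAggregate D fun k => gFormula D (site D k) (theta1SIVW σ D)

/-! ### Federated averaging -/

/-- Parameters of full-batch FedAvg: number of local steps, local learning rates, starting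
point. -/
structure FedAvgParams (K d : ℕ) where
  steps : ℕ
  rate : Fin K → ℝ
  init : Fin (d + 1) → ℝ

/-- Gradient at `θ` of the mean squared error over the observations in `s`. -/
def mseGrad (D : Dataset K d n) (s : Finset (Fin n)) (θ : Fin (d + 1) → ℝ) :
    Fin (d + 1) → ℝ :=
  (-(2 / (s.card : ℝ))) • ∑ i ∈ s, ((D i).y - aug (D i).x ⬝ᵥ θ) • aug (D i).x

/-- Local update of study `k`: `steps` gradient steps on its mean squared error in arm `w`. -/
def localUpdate (c : FedAvgParams K d) (D : Dataset K d n) (w : Fin 2) (k : Fin K)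
    (θ : Fin (d + 1) → ℝ) : Fin (d + 1) → ℝ :=
  (fun ϑ => ϑ - c.rate k • mseGrad D (cell D k w) ϑ)^[c.steps] θ

/-- Outcome parameters of arm `w` after `T` rounds of FedAvg; each round averages the local
updates with weights `n_k⁽ʷ⁾ / n⁽ʷ⁾`. -/
def fedAvg (c : FedAvgParams K d) (D : Dataset K d n) (w : Fin 2) (T : ℕ) :
    Fin (d + 1) → ℝ :=
  (fun θ => ∑ k, (((cell D k w).card : ℝ) / (arm D w).card) • localUpdate c D w k θ)^[T] c.init

end Estimators

/-- A choice of FedAvg parameters for each dataset and each arm. -/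
abbrev FedAvgRule (K d : ℕ) := (n : ℕ) → Dataset K d n → Fin 2 → FedAvgParams K d

/-- The parameters are chosen so that FedAvg recovers the pooled OLS estimator, in the limit of
many communication rounds, whenever the pooled regression has full rank. -/
def FedAvgRule.Tuned {K d : ℕ} (c : FedAvgRule K d) : Prop :=
  ∀ (n : ℕ) (D : Dataset K d n) (w : Fin 2), FullRank D (arm D w) →
    Tendsto (fedAvg (c n D w) D w) atTop (𝓝 (thetaPool D w))

/-- One local step per round, and a learning rate common to all studies which is positive and
smaller than `2 / L`, where `L` is the smoothness constant of the pooled mean squared error,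
that is, the largest eigenvalue of its Hessian `(2 / n⁽ʷ⁾) X'⁽ʷ⁾ᵀ X'⁽ʷ⁾`. -/
def FedAvgRule.OneStep {K d : ℕ} (c : FedAvgRule K d) : Prop :=
  ∀ (n : ℕ) (D : Dataset K d n) (w : Fin 2), FullRank D (arm D w) →
    (c n D w).steps = 1 ∧ ∃ η : ℝ, 0 < η ∧ (∀ k, (c n D w).rate k = η) ∧
      ∀ L : ℝ, Module.End.HasEigenvalue
        (Matrix.toLin' ((2 / ((arm D w).card : ℝ)) • gram D (arm D w))) L → η * L < 2

open Classical in
/-- Gradient-based federated outcome parameters: the limit of FedAvg as the number of rounds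
grows (set to `0` when the pooled regression is rank deficient). -/
def thetaGD {K d n : ℕ} (c : FedAvgRule K d) (D : Dataset K d n) (w : Fin 2) :
    Fin (d + 1) → ℝ :=
  if FullRank D (arm D w) then limUnder atTop (fedAvg (c n D w) D w) else 0

/-- Gradient-based federated estimator of the treatment effect. -/
def tauGD {K d n : ℕ} (c : FedAvgRule K d) (D : Dataset K d n) : ℝ :=
  swAggregate D fun k => gFormula D (site D k) (thetaGD c D)

/-! ### The sampling model -/

/-- Random sequences of covariates, treatments, studies and potential outcomes:
`pot i w` is the outcome that individual `i` would have in arm `w`. -/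
structure Population (K d : ℕ) (Ω : Type*) where
  X : ℕ → Ω → Fin d → ℝ
  W : ℕ → Ω → Fin 2
  H : ℕ → Ω → Fin K
  pot : ℕ → Fin 2 → Ω → ℝ

section Model

variable {K d : ℕ} {Ω : Type*} [MeasurableSpace Ω]

/-- The observed data of the first `n` individuals; the observed outcome is the potential
outcome of the arm received. -/
def Population.data (S : Population K d Ω) (n : ℕ) (ω : Ω) : Dataset K d n := fun i =>
  { x := S.X i ω, w := S.W i ω, h := S.H i ω, y := S.pot i (S.W i ω) ω }

/-- The average treatment effect `τ = E[Y(1) - Y(0)]`. -/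
def Population.ate (S : Population K d Ω) (P : Measure Ω) : ℝ :=
  ∫ ω, (S.pot 0 1 ω - S.pot 0 0 ω) ∂P

/-- `ρ_k = P(H = k)`. -/
def Population.rho (S : Population K d Ω) (P : Measure Ω) (k : Fin K) : ℝ :=
  P.real (S.H 0 ⁻¹' {k})

/-- `p_k = P(W = 1 | H = k)`. -/
def Population.pStudy (S : Population K d Ω) (P : Measure Ω) (k : Fin K) : ℝ :=
  (P[|S.H 0 ⁻¹' {k}]).real (S.W 0 ⁻¹' {1})

/-- `p = P(W = 1)`. -/
def Population.pTreat (S : Population K d Ω) (P : Measure Ω) : ℝ :=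
  P.real (S.W 0 ⁻¹' {1})

/-- `Σ`, the covariance matrix of the covariates. -/
def Population.covX (S : Population K d Ω) (P : Measure Ω) : Matrix (Fin d) (Fin d) ℝ :=
  Matrix.of fun a b => cov[fun ω => S.X 0 ω a, fun ω => S.X 0 ω b; P]

/-- The noise `ε_i(w) = Y_i(w) - c⁽ʷ⁾ - X_i β⁽ʷ⁾` of the linear outcome model. -/
def Population.noise (S : Population K d Ω) (c : Fin 2 → ℝ) (β : Fin 2 → Fin d → ℝ)
    (i : ℕ) (w : Fin 2) (ω : Ω) : ℝ :=
  S.pot i w ω - (c w + S.X i ω ⬝ᵥ β w)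

/-- The homogeneous multi-study Bernoulli trial with a linear outcome model. -/
structure Homogeneous (S : Population K d Ω) (P : Measure Ω)
    (c : Fin 2 → ℝ) (β : Fin 2 → Fin d → ℝ) (σ : ℝ) : Prop where
  measurable_X : ∀ i, Measurable (S.X i)
  measurable_W : ∀ i, Measurable (S.W i)
  measurable_H : ∀ i, Measurable (S.H i)
  measurable_pot : ∀ i w, Measurable (S.pot i w)
  /-- The individuals are independent. -/
  indep : iIndepFun (fun i ω => (S.X i ω, S.W i ω, S.H i ω, fun w => S.pot i w ω)) P
  /-- The individuals are identically distributed. -/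
  ident : ∀ i, IdentDistrib (fun ω => (S.X i ω, S.W i ω, S.H i ω, fun w => S.pot i w ω))
    (fun ω => (S.X 0 ω, S.W 0 ω, S.H 0 ω, fun w => S.pot 0 w ω)) P P
  /-- Randomization within studies, and no effect of the study on covariates or outcomes:
  `(X, Y(0), Y(1))` is independent of `(H, W)`. The treatment may depend on the study. -/
  indep_design : ∀ i, IndepFun (fun ω => (S.X i ω, fun w => S.pot i w ω))
    (fun ω => (S.H i ω, S.W i ω)) P
  /-- Every study has a positive share of the individuals. -/
  rho_pos : ∀ k, 0 < S.rho P k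
  /-- Positivity of the treatment assignment in every study. -/
  pStudy_mem : ∀ k, 0 < S.pStudy P k ∧ S.pStudy P k < 1
  /-- The covariates have finite second moments. -/
  memLp_X : ∀ i, MemLp (S.X i) 2 P
  /-- Full rank of the regression with intercept, at the level of the population. -/
  posDef_covX : (S.covX P).PosDef
  sigma_pos : 0 < σ
  memLp_noise : ∀ i w, MemLp (S.noise c β i w) 2 P
  /-- `E[ε(w) | X] = 0`. -/
  noise_mean : ∀ i w,
    P[S.noise c β i w | MeasurableSpace.comap (S.X i) inferInstance] =ᵐ[P] fun _ => 0
  /-- `V[ε(w) | X] = σ²`. -/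
  noise_var : ∀ i w,
    Var[S.noise c β i w; P | MeasurableSpace.comap (S.X i) inferInstance] =ᵐ[P] fun _ => σ ^ 2

/-- `V` is the asymptotic variance, at the scale of the sample sizes `N n`, of the estimators
`T n` of `τ`: `√(N n) (T n - τ)` converges in distribution to `𝒩(0, V)`. -/
def IsAsymptoticVariance (P : Measure Ω) [IsProbabilityMeasure P] (N : ℕ → Ω → ℕ)
    (T : ℕ → Ω → ℝ) (τ V : ℝ) : Prop :=
  0 ≤ V ∧ TendstoInDistribution (fun n ω => √(N n ω : ℝ) * (T n ω - τ)) atTop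
    (id : ℝ → ℝ) (fun _ => P) (gaussianReal 0 V.toNNReal)

/-- `‖β⁽¹⁾ - β⁽⁰⁾‖²_Σ`. -/
def Population.effectSq (S : Population K d Ω) (P : Measure Ω) (β : Fin 2 → Fin d → ℝ) : ℝ :=
  (β 1 - β 0) ⬝ᵥ (S.covX P).mulVec (β 1 - β 0)

/-- Asymptotic variance of the local estimator of study `k`, at scale `n_k`. -/
def Population.avarLocal (S : Population K d Ω) (P : Measure Ω) (β : Fin 2 → Fin d → ℝ)
    (σ : ℝ) (k : Fin K) : ℝ :=
  σ ^ 2 / (S.pStudy P k * (1 - S.pStudy P k)) + S.effectSq P β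

/-- Asymptotic variance of the pooled estimator, at scale `n`. -/
def Population.avarPool (S : Population K d Ω) (P : Measure Ω) (β : Fin 2 → Fin d → ℝ)
    (σ : ℝ) : ℝ :=
  σ ^ 2 / (S.pTreat P * (1 - S.pTreat P)) + S.effectSq P β

/-- Asymptotic variance of the inverse-variance weighted meta-analysis, at scale `n`. -/
def Population.avarMetaIVW (S : Population K d Ω) (P : Measure Ω) (β : Fin 2 → Fin d → ℝ)
    (σ : ℝ) : ℝ :=
  (∑ k, S.rho P k / S.avarLocal P β σ k)⁻¹

/-- Asymptotic variance of the sample-size weighted meta-analysis, at scale `n`. -/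
def Population.avarMetaSW (S : Population K d Ω) (P : Measure Ω) (β : Fin 2 → Fin d → ℝ)
    (σ : ℝ) : ℝ :=
  σ ^ 2 * (∑ k, S.rho P k / (S.pStudy P k * (1 - S.pStudy P k))) + S.effectSq P β

end Model

end

end FedCausal

/-! Each estimator is asymptotically linear: √n (T - τ) equals n^{-1/2} ∑ f(ζ_i), up to a term
tending to zero in probability, where the ζ_i are the i.i.d. records of the individuals and f is
centred and square integrable. The central limit theorem then gives a normal limit with variance E
f(ζ_0)², so each asymptotic variance is one second moment. `HasInfluence` records this property. It
is stable under finite sums, under factors that converge almost surely, and under modifications that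
almost surely disappear for large n; the last point disposes of the default values of rank-deficient
regressions.

For least squares over a set C of (study, arm) cells inside arm w, √n (θ̂ - θ) is eventually exactly
the inverse of Gram/n applied to n^{-1/2} times the sum of the scores ε X' (`sqrt_mul_ols_sub`).
Since the design is independent of covariates and outcomes, Gram/n tends to π M, where π is the
probability of C and M is the second moment matrix of X', the same for all C. The plug-in formula
contracts this with E X', the first row of M, and E X' M⁻¹ is the first unit vector
(`Homogeneous.meanAug_vecMul_inv`). Hence only ± ε/π remains from the regressions, whatever the law
of X. The average of X' adds the centred effect X(β⁽¹⁾ - β⁽⁰⁾), which is orthogonal to the noise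
(`Homogeneous.hasInfluence_gFormula`, `Homogeneous.integral_effectInfluence_sq`).

The one-shot and gradient-based parameters have the influence function of the pooled regression. The
local estimators have influence functions supported on disjoint studies, so their variances add in
the meta-analyses.

For the comparison, let e be the variance of the effect. Then 1/v_k = g(p_k(1 - p_k)) with g(u) =
u/(σ² + e u) increasing and concave, and ∑ ρ_k p_k(1 - p_k) is p(1 - p) minus the variance of the
p_k. The tangent to g at p(1 - p) gives the first inequality (`pooled_le_inv_sum_div`); the second
is between harmonic and arithmetic means (`inv_sum_div_le`). -/

set_option linter.unusedSectionVars false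

namespace FedCausal

noncomputable section

/-! ### Asymptotically linear sequences and their calculus -/

section Linearization

variable {Ω R : Type*} [MeasurableSpace Ω] [MeasurableSpace R] {P : Measure Ω}
  [IsProbabilityMeasure P]

/-- The product of a sequence tending to zero in probability with a sequence bounded in
probability tends to zero in probability. -/
lemma tendstoInMeasure_mul_of_bounded {X Y : ℕ → Ω → ℝ}
    (hX : TendstoInMeasure P X atTop 0)
    (hY : ∀ δ > 0, ∃ M > 0, ∀ᶠ n in atTop, P.real {ω | M ≤ |Y n ω|} ≤ δ) :
    TendstoInMeasure P (fun n ω => X n ω * Y n ω) atTop 0 := by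
  rw [tendstoInMeasure_iff_measureReal_norm] at hX ⊢
  intro ε hε
  rw [Metric.tendsto_nhds]
  intro δ hδ
  obtain ⟨M, hM, hYM⟩ := hY (δ / 2) (by positivity)
  have hX' := (hX (ε / M) (by positivity)).eventually_lt_const (show 0 < δ / 2 by positivity)
  filter_upwards [hYM, hX'] with n hn1 hn2
  rw [Real.dist_eq, sub_zero, abs_of_nonneg measureReal_nonneg]
  have hsub : {ω | ε ≤ ‖X n ω * Y n ω - (0 : Ω → ℝ) ω‖} ⊆
      {ω | ε / M ≤ ‖X n ω - (0 : Ω → ℝ) ω‖} ∪ {ω | M ≤ |Y n ω|} := by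
    intro ω hω
    by_contra hcon
    simp only [Set.mem_union, Set.mem_ofPred_eq, not_or, not_le, Pi.zero_apply, sub_zero,
      Real.norm_eq_abs, abs_mul] at hω hcon
    have := mul_lt_mul'' hcon.1 hcon.2 (abs_nonneg _) (abs_nonneg _)
    rw [div_mul_cancel₀ _ hM.ne'] at this
    linarith
  calc _ ≤ _ := measureReal_mono hsub
    _ ≤ _ := measureReal_union_le _ _
    _ < δ := by linarith

/-- A sequence tending to zero in probability is bounded in probability. -/
lemma bounded_of_tendstoInMeasure {X : ℕ → Ω → ℝ}
    (hX : TendstoInMeasure P X atTop 0) :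
    ∀ δ > 0, ∃ M > 0, ∀ᶠ n in atTop, P.real {ω | M ≤ |X n ω|} ≤ δ := by
  intro δ hδ
  rw [tendstoInMeasure_iff_measureReal_norm] at hX
  refine ⟨1, one_pos, ?_⟩
  filter_upwards [(hX 1 one_pos).eventually_lt_const hδ] with n hn
  simpa using hn.le

lemma tendstoInMeasure_zero_add {X Y : ℕ → Ω → ℝ}
    (hX : TendstoInMeasure P X atTop 0) (hY : TendstoInMeasure P Y atTop 0) :
    TendstoInMeasure P (fun n ω => X n ω + Y n ω) atTop 0 := by
  rw [tendstoInMeasure_iff_norm] at hX hY ⊢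
  intro ε hε
  have hsum := (hX (ε / 2) (by positivity)).add (hY (ε / 2) (by positivity))
  rw [add_zero] at hsum
  refine tendsto_of_tendsto_of_tendsto_of_le_of_le tendsto_const_nhds hsum
    (fun _ => zero_le) fun n => ?_
  refine (measure_mono ?_).trans (measure_union_le _ _)
  intro ω hω
  by_contra hcon
  simp only [Set.mem_union, Set.mem_ofPred_eq, not_or, not_le, Pi.zero_apply, sub_zero] at hω hcon
  have := norm_add_le (X n ω) (Y n ω)
  linarith

/-- The normalised sum `n^{-1/2} ∑ f(ζ_i)`. -/
def rootSum (ζ : ℕ → Ω → R) (f : R → ℝ) (n : ℕ) (ω : Ω) : ℝ :=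
  (√(n : ℝ))⁻¹ * ∑ i ∈ Finset.range n, f (ζ i ω)

/-- The sequence `T` is asymptotically linear with centred, square integrable influence function
`f`: it equals `n^{-1/2} ∑ f(ζ_i)` up to a term tending to zero in probability. -/
structure HasInfluence (P : Measure Ω) (ζ : ℕ → Ω → R) (T : ℕ → Ω → ℝ) (f : R → ℝ) : Prop where
  measurable : Measurable f
  memLp : MemLp (fun ω => f (ζ 0 ω)) 2 P
  centred : ∫ ω, f (ζ 0 ω) ∂P = 0
  aemeasurable : ∀ n, AEMeasurable (T n) P
  tendsto : TendstoInMeasure P (fun n ω => T n ω - rootSum ζ f n ω) atTop 0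

/-- A measurable, independent and identically distributed sequence. -/
structure IsIID (P : Measure Ω) (ζ : ℕ → Ω → R) : Prop where
  measurable : ∀ i, Measurable (ζ i)
  indep : iIndepFun ζ P
  ident : ∀ i, IdentDistrib (ζ i) (ζ 0) P P

variable {ζ : ℕ → Ω → R} {T T' : ℕ → Ω → ℝ} {f g : R → ℝ}

lemma IsIID.aemeasurable_rootSum (hζ : IsIID P ζ) (hf : Measurable f) (n : ℕ) :
    AEMeasurable (rootSum ζ f n) P := by
  have h := fun i => hf.comp (hζ.measurable i)
  have : Measurable (rootSum ζ f n) := by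
    unfold rootSum
    exact (Finset.measurable_sum _ fun i _ => h i).const_mul _
  exact this.aemeasurable

lemma IsIID.hasInfluence_rootSum (hζ : IsIID P ζ) (hf : Measurable f)
    (h2 : MemLp (fun ω => f (ζ 0 ω)) 2 P) (h0 : ∫ ω, f (ζ 0 ω) ∂P = 0) :
    HasInfluence P ζ (rootSum ζ f) f :=
  ⟨hf, h2, h0, hζ.aemeasurable_rootSum hf, by
    simp only [sub_self]
    rw [tendstoInMeasure_iff_norm]
    intro ε hε
    simp [hε.not_ge]⟩

lemma HasInfluence.add (h : HasInfluence P ζ T f) (h' : HasInfluence P ζ T' g) :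
    HasInfluence P ζ (fun n ω => T n ω + T' n ω) (fun r => f r + g r) := by
  refine ⟨h.measurable.add h'.measurable, h.memLp.add h'.memLp, ?_,
    fun n => (h.aemeasurable n).add (h'.aemeasurable n), ?_⟩
  · rw [integral_add (h.memLp.integrable (by norm_num)) (h'.memLp.integrable (by norm_num)),
      h.centred, h'.centred, add_zero]
  · convert tendstoInMeasure_zero_add h.tendsto h'.tendsto using 3 with n ω
    simp only [rootSum, Finset.sum_add_distrib]
    ring

lemma IsIID.hasInfluence_zero (hζ : IsIID P ζ) : HasInfluence P ζ (fun _ _ => 0) (fun _ => 0) := by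
  have h : rootSum ζ (fun _ => 0) = fun _ _ => 0 := by
    funext n ω
    simp [rootSum]
  simpa [h] using hζ.hasInfluence_rootSum (f := fun _ => 0) measurable_const (by simp) (by simp)

lemma IsIID.hasInfluence_sum (hζ : IsIID P ζ) {ι : Type*} (s : Finset ι)
    {T : ι → ℕ → Ω → ℝ} {f : ι → R → ℝ} (h : ∀ j ∈ s, HasInfluence P ζ (T j) (f j)) :
    HasInfluence P ζ (fun n ω => ∑ j ∈ s, T j n ω) (fun r => ∑ j ∈ s, f j r) := by
  classical
  induction s using Finset.induction_on with
  | empty => simpa using hζ.hasInfluence_zero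
  | insert a s ha ih =>
    simp only [Finset.sum_insert ha]
    exact (h a (by simp)).add (ih fun j hj => h j (by simp [hj]))

/-- A difference that is almost surely eventually zero tends to zero in probability. This is what
makes default values harmless: identities valid under full rank need to hold only for large n.
Measurability of the new sequence is not inherited, since for small n it is unrelated to the old
one. -/
lemma HasInfluence.congr (h : HasInfluence P ζ T f) (hT' : ∀ n, AEMeasurable (T' n) P)
    (hTT : ∀ᵐ ω ∂P, ∀ᶠ n in atTop, T' n ω = T n ω) : HasInfluence P ζ T' f := by
  refine ⟨h.measurable, h.memLp, h.centred, hT', ?_⟩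
  have h0 : TendstoInMeasure P (fun n ω => T' n ω - T n ω) atTop 0 := by
    refine tendstoInMeasure_of_tendsto_ae
      (fun n => ((hT' n).sub (h.aemeasurable n)).aestronglyMeasurable) ?_
    filter_upwards [hTT] with ω hω
    refine tendsto_const_nhds.congr' ?_
    filter_upwards [hω] with n hn
    simp [hn]
  convert tendstoInMeasure_zero_add h0 h.tendsto using 3 with n ω
  ring

lemma IsIID.memLp_comp (hζ : IsIID P ζ) (hf : Measurable f)
    (h2 : MemLp (fun ω => f (ζ 0 ω)) 2 P) (i : ℕ) : MemLp (fun ω => f (ζ i ω)) 2 P :=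
  ((hζ.ident i).comp hf).symm.memLp_snd h2

lemma IsIID.integral_comp (hζ : IsIID P ζ) (hf : Measurable f) (i : ℕ) :
    ∫ ω, f (ζ i ω) ∂P = ∫ ω, f (ζ 0 ω) ∂P :=
  ((hζ.ident i).comp hf).integral_eq

/-- Chebyshev's inequality, as the variance of the normalised sum is at most that of f for every n.
-/
lemma IsIID.rootSum_bounded (hζ : IsIID P ζ) (hf : Measurable f)
    (h2 : MemLp (fun ω => f (ζ 0 ω)) 2 P) (h0 : ∫ ω, f (ζ 0 ω) ∂P = 0) :
    ∀ δ > 0, ∃ M > 0, ∀ᶠ n in atTop, P.real {ω | M ≤ |rootSum ζ f n ω|} ≤ δ := by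
  intro δ hδ
  set v := Var[fun ω => f (ζ 0 ω); P] with hv
  have hv0 : 0 ≤ v := variance_nonneg _ _
  have hi := hζ.memLp_comp hf h2
  -- Chebyshev needs v / M² ≤ δ; the added 1 keeps M positive when v = 0.
  refine ⟨√(v / δ) + 1, by positivity, Eventually.of_forall fun n => ?_⟩
  have hrs : rootSum ζ f n =
      fun ω => (√(n : ℝ))⁻¹ * (∑ i ∈ Finset.range n, fun ω => f (ζ i ω)) ω := by
    funext ω
    simp [rootSum]
  have hmem : MemLp (rootSum ζ f n) 2 P := by
    rw [hrs]
    exact (memLp_finsetSum' _ fun i _ => hi i).const_mul _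
  have hvar : Var[rootSum ζ f n; P] ≤ v := by
    rw [hrs, variance_const_mul, IndepFun.variance_sum (fun i _ => hi i)]
    · have : ∀ i ∈ Finset.range n, Var[fun ω => f (ζ i ω); P] = v := fun i _ =>
        ((hζ.ident i).comp hf).variance_eq
      rw [Finset.sum_congr rfl this, Finset.sum_const, Finset.card_range, nsmul_eq_mul, inv_pow,
        Real.sq_sqrt (by positivity), ← mul_assoc]
      exact mul_le_of_le_one_left hv0 (inv_mul_le_one)
    · intro i _ j _ hij
      exact (hζ.indep.indepFun hij).comp hf hf
  have hmean : ∫ ω, rootSum ζ f n ω ∂P = 0 := by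
    unfold rootSum
    rw [integral_const_mul, integral_finsetSum _ fun i _ => (hi i).integrable (by norm_num)]
    simp [hζ.integral_comp hf, h0]
  have hM : 0 < √(v / δ) + 1 := by positivity
  have hcheb := meas_ge_le_variance_div_sq hmem hM
  rw [hmean] at hcheb
  simp only [sub_zero] at hcheb
  refine (ENNReal.toReal_le_of_le_ofReal
    (div_nonneg (variance_nonneg _ _) (sq_nonneg _)) hcheb).trans ?_
  rw [div_le_iff₀ (by positivity)]
  have h1 : v / δ ≤ (√(v / δ) + 1) ^ 2 := by
    nlinarith [Real.sq_sqrt (div_nonneg hv0 hδ.le), Real.sqrt_nonneg (v / δ)]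
  rw [div_le_iff₀ hδ] at h1
  linarith

/-- A factor converging almost surely multiplies the influence function by its limit. -/
lemma HasInfluence.mul (hζ : IsIID P ζ) (h : HasInfluence P ζ T f) {B : ℕ → Ω → ℝ} {b : ℝ}
    (hB : ∀ n, AEMeasurable (B n) P) (hBb : ∀ᵐ ω ∂P, Tendsto (fun n => B n ω) atTop (𝓝 b)) :
    HasInfluence P ζ (fun n ω => B n ω * T n ω) (fun r => b * f r) := by
  refine ⟨h.measurable.const_mul b, h.memLp.const_mul b, ?_,
    fun n => (hB n).mul (h.aemeasurable n), ?_⟩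
  · rw [integral_const_mul, h.centred, mul_zero]
  have hB0 : TendstoInMeasure P (fun n ω => B n ω - b) atTop 0 := by
    refine tendstoInMeasure_of_tendsto_ae
      (fun n => ((hB n).sub_const b).aestronglyMeasurable) ?_
    filter_upwards [hBb] with ω hω
    simpa using hω.sub_const b
  have hb0 : TendstoInMeasure P (fun n ω => b * (T n ω - rootSum ζ f n ω)) atTop 0 := by
    simp_rw [mul_comm b]
    refine tendstoInMeasure_mul_of_bounded h.tendsto fun δ hδ =>
      ⟨|b| + 1, by positivity, Eventually.of_forall fun n => ?_⟩
    have : ¬ (|b| + 1 ≤ |b|) := by linarith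
    simpa [this] using hδ.le
  -- With R the normalised sum, B T - b R = (B - b)(T - R) + (B - b) R + b (T - R), and each of the
  -- three terms tends to zero in probability.
  have h1 := tendstoInMeasure_mul_of_bounded hB0 (bounded_of_tendstoInMeasure h.tendsto)
  have h2 := tendstoInMeasure_mul_of_bounded hB0
    (hζ.rootSum_bounded h.measurable h.memLp h.centred)
  convert tendstoInMeasure_zero_add (tendstoInMeasure_zero_add h1 h2) hb0 using 3 with n ω
  simp only [rootSum, ← Finset.mul_sum]
  ring

lemma HasInfluence.const_mul (hζ : IsIID P ζ) (h : HasInfluence P ζ T f) (b : ℝ) :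
    HasInfluence P ζ (fun n ω => b * T n ω) (fun r => b * f r) :=
  h.mul hζ (fun _ => aemeasurable_const) (ae_of_all _ fun _ => tendsto_const_nhds)

/-- An asymptotically linear sequence is asymptotically normal, with the second moment of the
influence function as its variance. -/
lemma HasInfluence.tendstoInDistribution (hζ : IsIID P ζ) (h : HasInfluence P ζ T f) :
    TendstoInDistribution T atTop (id : ℝ → ℝ) (fun _ => P)
      (gaussianReal 0 (∫ ω, f (ζ 0 ω) ^ 2 ∂P).toNNReal) := by
  have hvar : Var[fun ω => f (ζ 0 ω); P] = ∫ ω, f (ζ 0 ω) ^ 2 ∂P :=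
    variance_of_integral_eq_zero h.memLp.aemeasurable h.centred
  have hclt := tendstoInDistribution_inv_sqrt_mul_sum_sub (P := P) (X := fun i ω => f (ζ i ω))
    (P' := gaussianReal 0 (∫ ω, f (ζ 0 ω) ^ 2 ∂P).toNNReal) (Y := id)
    ⟨aemeasurable_id, by rw [Measure.map_id, hvar]⟩ h.memLp
    (hζ.indep.comp (fun _ => f) fun _ => h.measurable)
    (fun i => (hζ.ident i).comp h.measurable)
  refine tendstoInDistribution_of_tendstoInMeasure_sub _ _ hclt ?_ h.aemeasurable
  convert h.tendsto using 3 with n ω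
  simp [rootSum, h.centred]

/-- The strong law of large numbers along a measurable function of the observations. -/
lemma IsIID.strong_law (hζ : IsIID P ζ) (hf : Measurable f)
    (h1 : Integrable (fun ω => f (ζ 0 ω)) P) :
    ∀ᵐ ω ∂P, Tendsto (fun n : ℕ => (∑ i ∈ Finset.range n, f (ζ i ω)) / n) atTop
      (𝓝 (∫ ω, f (ζ 0 ω) ∂P)) :=
  strong_law_ae_real (fun i ω => f (ζ i ω)) h1
    (fun _ _ hij => (hζ.indep.indepFun hij).comp hf hf) fun i => (hζ.ident i).comp hf

end Linearization

/-! ### Records, independence of the design, and moments of the noise -/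

section Moments

variable {K d : ℕ} {Ω : Type*} [MeasurableSpace Ω] {P : Measure Ω} [IsProbabilityMeasure P]
  {S : Population K d Ω} {c : Fin 2 → ℝ} {β : Fin 2 → Fin d → ℝ} {σ : ℝ}

/-- The full record of an individual: covariates, treatment, study, potential outcomes. -/
abbrev Record (K d : ℕ) := (Fin d → ℝ) × Fin 2 × Fin K × (Fin 2 → ℝ)

/-- The record of individual `i`. -/
def Population.record (S : Population K d Ω) (i : ℕ) (ω : Ω) : Record K d :=
  (S.X i ω, S.W i ω, S.H i ω, fun w => S.pot i w ω)

lemma Homogeneous.isIID (hS : Homogeneous S P c β σ) : IsIID P S.record :=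
  ⟨fun i => (hS.measurable_X i).prodMk ((hS.measurable_W i).prodMk
    ((hS.measurable_H i).prodMk (measurable_pi_lambda _ fun w => hS.measurable_pot i w))),
    hS.indep, hS.ident⟩

/-- Evaluation of a function of the study and arm, and of the covariates and potential
outcomes. -/
def onRecord (F : Fin K × Fin 2 → (Fin d → ℝ) × (Fin 2 → ℝ) → ℝ) (r : Record K d) : ℝ :=
  F (r.2.2.1, r.2.1) (r.1, r.2.2.2)

/-- The probability of a study and arm. -/
def Population.pCell (S : Population K d Ω) (P : Measure Ω) (q : Fin K × Fin 2) : ℝ :=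
  P.real ((fun ω => (S.H 0 ω, S.W 0 ω)) ⁻¹' {q})

/-- The finite decomposition over cells turns a function of the whole record into products of a
function of (X, Y(0), Y(1)) with a cell indicator, to which independence of the design applies. -/
lemma onRecord_eq_sum (F : Fin K × Fin 2 → (Fin d → ℝ) × (Fin 2 → ℝ) → ℝ) (r : Record K d) :
    onRecord F r = ∑ q, F q (r.1, r.2.2.2) * (if (r.2.2.1, r.2.1) = q then 1 else 0) := by
  simp [onRecord]

lemma onRecord_record (F : Fin K × Fin 2 → (Fin d → ℝ) × (Fin 2 → ℝ) → ℝ) (ω : Ω) :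
    onRecord F (S.record 0 ω) = ∑ q, F q (S.X 0 ω, fun w => S.pot 0 w ω) *
      (if (S.H 0 ω, S.W 0 ω) = q then 1 else 0) :=
  onRecord_eq_sum F _

lemma measurable_onRecord {F : Fin K × Fin 2 → (Fin d → ℝ) × (Fin 2 → ℝ) → ℝ}
    (hF : ∀ q, Measurable (F q)) : Measurable (onRecord F) := by
  have : onRecord F = fun r =>
      ∑ q, F q (r.1, r.2.2.2) * (if (r.2.2.1, r.2.1) = q then 1 else 0) :=
    funext fun r => onRecord_eq_sum F r
  rw [this]
  refine Finset.measurable_sum _ fun q _ => ((hF q).comp (by fun_prop)).mul ?_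
  refine Measurable.ite ?_ measurable_const measurable_const
  exact (measurableSet_singleton q).preimage
    (f := fun r : Record K d => (r.2.2.1, r.2.1)) (by fun_prop)

lemma Homogeneous.memLp_onRecord (hS : Homogeneous S P c β σ) {p : ENNReal}
    {F : Fin K × Fin 2 → (Fin d → ℝ) × (Fin 2 → ℝ) → ℝ}
    (h2 : ∀ q, MemLp (fun ω => F q (S.X 0 ω, fun w => S.pot 0 w ω)) p P) :
    MemLp (fun ω => onRecord F (S.record 0 ω)) p P := by
  have : (fun ω => onRecord F (S.record 0 ω)) = fun ω => ∑ q,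
      ((fun ω => (S.H 0 ω, S.W 0 ω)) ⁻¹' {q}).indicator
        (fun ω => F q (S.X 0 ω, fun w => S.pot 0 w ω)) ω := by
    funext ω
    rw [onRecord_record]
    refine Finset.sum_congr rfl fun q _ => ?_
    by_cases h : (S.H 0 ω, S.W 0 ω) = q <;> simp [h]
  rw [this]
  exact memLp_finsetSum _ fun q _ => (h2 q).indicator
    ((measurableSet_singleton q).preimage ((hS.measurable_H 0).prodMk (hS.measurable_W 0)))

/-- The study and arm are independent of the covariates and potential outcomes. -/
lemma Homogeneous.integral_onRecord (hS : Homogeneous S P c β σ)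
    {F : Fin K × Fin 2 → (Fin d → ℝ) × (Fin 2 → ℝ) → ℝ} (hF : ∀ q, Measurable (F q))
    (h1 : ∀ q, Integrable (fun ω => F q (S.X 0 ω, fun w => S.pot 0 w ω)) P) :
    ∫ ω, onRecord F (S.record 0 ω) ∂P =
      ∑ q, S.pCell P q * ∫ ω, F q (S.X 0 ω, fun w => S.pot 0 w ω) ∂P := by
  have hmX : Measurable fun ω => (S.X 0 ω, fun w => S.pot 0 w ω) :=
    (hS.measurable_X 0).prodMk (measurable_pi_lambda _ fun w => hS.measurable_pot 0 w)
  have hmH : Measurable fun ω => (S.H 0 ω, S.W 0 ω) :=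
    (hS.measurable_H 0).prodMk (hS.measurable_W 0)
  have hms : ∀ q, MeasurableSet ((fun ω => (S.H 0 ω, S.W 0 ω)) ⁻¹' {q}) := fun q =>
    (measurableSet_singleton q).preimage hmH
  simp_rw [onRecord_record]
  have hmind : ∀ q : Fin K × Fin 2, Measurable fun x : Fin K × Fin 2 =>
    (if x = q then (1 : ℝ) else 0) := fun q => measurable_of_finite _
  rw [integral_finsetSum]
  · refine Finset.sum_congr rfl fun q _ => ?_
    have := (hS.indep_design 0).integral_fun_comp_mul_comp (𝕜 := ℝ) hmX.aemeasurable
      hmH.aemeasurable (f := F q) (g := fun x => if x = q then 1 else 0)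
      (hF q).aestronglyMeasurable (hmind q).aestronglyMeasurable
    rw [this, mul_comm]
    congr 1
    have h2 : (fun ω => if (S.H 0 ω, S.W 0 ω) = q then (1 : ℝ) else 0) =
        ((fun ω => (S.H 0 ω, S.W 0 ω)) ⁻¹' {q}).indicator (fun _ => 1) := by
      funext ω
      by_cases h : (S.H 0 ω, S.W 0 ω) = q <;> simp [h]
    rw [h2, integral_indicator (hms q)]
    simp [Population.pCell]
  · intro q _
    refine ((h1 q).indicator (hms q)).congr (ae_of_all _ fun ω => ?_)
    by_cases h : (S.H 0 ω, S.W 0 ω) = q <;> simp [h]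

lemma Homogeneous.measurable_noise (hS : Homogeneous S P c β σ) (w : Fin 2) :
    Measurable (S.noise c β 0 w) := by
  have h := hS.measurable_X 0
  unfold Population.noise
  refine (hS.measurable_pot 0 w).sub (measurable_const.add ?_)
  simp only [dotProduct]
  exact Finset.measurable_sum _ fun a _ => ((measurable_pi_apply a).comp h).mul_const _

lemma Homogeneous.integral_noise (hS : Homogeneous S P c β σ) (w : Fin 2) :
    ∫ ω, S.noise c β 0 w ω ∂P = 0 := by
  rw [← integral_condExp (hS.measurable_X 0).comap_le, integral_congr_ae (hS.noise_mean 0 w)]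
  simp

/-- The conditional variance is the conditional second moment around the conditional mean, which is
zero here. -/
lemma Homogeneous.condExp_noise_sq (hS : Homogeneous S P c β σ) (w : Fin 2) :
    P[fun ω => S.noise c β 0 w ω ^ 2 | MeasurableSpace.comap (S.X 0) inferInstance]
      =ᵐ[P] fun _ => σ ^ 2 := by
  refine Filter.EventuallyEq.trans ?_ (hS.noise_var 0 w)
  refine condExp_congr_ae ?_
  filter_upwards [hS.noise_mean 0 w] with ω hω
  simp [hω]

/-- The measures with densities ε² and σ² agree on the σ-algebra of X. Stating this for nonnegative
integrals avoids any integrability condition on f. It is needed because ε and f(X) are only square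
integrable, so Hölder's inequality does not make their product square integrable; homoscedasticity
does. -/
lemma Homogeneous.lintegral_noise_sq_mul (hS : Homogeneous S P c β σ) (w : Fin 2)
    {f : (Fin d → ℝ) → ENNReal} (hf : Measurable f) :
    ∫⁻ ω, ENNReal.ofReal (S.noise c β 0 w ω ^ 2) * f (S.X 0 ω) ∂P =
      ENNReal.ofReal (σ ^ 2) * ∫⁻ ω, f (S.X 0 ω) ∂P := by
  have hm := (hS.measurable_X 0).comap_le
  have hmn := hS.measurable_noise w
  have hint : Integrable (fun ω => S.noise c β 0 w ω ^ 2) P := (hS.memLp_noise 0 w).integrable_sq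
  have htrim : (P.withDensity fun ω => ENNReal.ofReal (S.noise c β 0 w ω ^ 2)).trim hm =
      (ENNReal.ofReal (σ ^ 2) • P).trim hm := by
    refine @Measure.ext _ (MeasurableSpace.comap (S.X 0) inferInstance) _ _ fun s hs => ?_
    rw [trim_measurableSet_eq hm hs, trim_measurableSet_eq hm hs, withDensity_apply _ (hm _ hs),
      ← ofReal_integral_eq_lintegral_ofReal hint.integrableOn
        (ae_of_all _ fun ω => sq_nonneg _), ← setIntegral_condExp hm hint hs,
      integral_congr_ae (ae_restrict_of_ae (hS.condExp_noise_sq w))]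
    simp [ENNReal.ofReal_mul', Measure.real, mul_comm]
  have hfm : Measurable[MeasurableSpace.comap (S.X 0) inferInstance] fun ω => f (S.X 0 ω) :=
    hf.comp (comap_measurable _)
  have h1 := lintegral_trim (μ := P.withDensity fun ω => ENNReal.ofReal (S.noise c β 0 w ω ^ 2))
    hm hfm
  rw [htrim, lintegral_trim hm hfm, lintegral_smul_measure,
    lintegral_withDensity_eq_lintegral_mul (g := fun ω => f (S.X 0 ω)) _ (by fun_prop)
      (hf.comp (hS.measurable_X 0))] at h1
  exact h1.symm

/-- Homoscedasticity: the noise times a square integrable function of the covariates is square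
integrable. -/
lemma Homogeneous.memLp_noise_mul (hS : Homogeneous S P c β σ) (w : Fin 2)
    {f : (Fin d → ℝ) → ℝ} (hf : Measurable f) (h2 : MemLp (fun ω => f (S.X 0 ω)) 2 P) :
    MemLp (fun ω => S.noise c β 0 w ω * f (S.X 0 ω)) 2 P := by
  have hmn := hS.measurable_noise w
  have hfX := hf.comp (hS.measurable_X 0)
  have hm : Measurable fun ω => S.noise c β 0 w ω * f (S.X 0 ω) := hmn.mul hfX
  rw [memLp_two_iff_integrable_sq hm.aestronglyMeasurable]
  refine ⟨(hm.pow_const 2).aestronglyMeasurable, ?_⟩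
  have h := hS.lintegral_noise_sq_mul w (f := fun x => ENNReal.ofReal (f x ^ 2)) (by fun_prop)
  rw [hasFiniteIntegral_iff_ofReal (ae_of_all _ fun ω => sq_nonneg _)]
  simp_rw [mul_pow, ENNReal.ofReal_mul (sq_nonneg _)]
  rw [h]
  refine ENNReal.mul_lt_top ENNReal.ofReal_lt_top ?_
  exact (hasFiniteIntegral_iff_ofReal (ae_of_all _ fun ω => sq_nonneg _)).1 h2.integrable_sq.2

/-- The factor f(X) comes out of the conditional expectation given X, leaving E(ε | X) = 0. -/
lemma Homogeneous.integral_noise_mul (hS : Homogeneous S P c β σ) (w : Fin 2)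
    {f : (Fin d → ℝ) → ℝ} (hf : Measurable f) (h2 : MemLp (fun ω => f (S.X 0 ω)) 2 P) :
    ∫ ω, S.noise c β 0 w ω * f (S.X 0 ω) ∂P = 0 := by
  have hm := (hS.measurable_X 0).comap_le
  have hfm : StronglyMeasurable[MeasurableSpace.comap (S.X 0) inferInstance]
      fun ω => f (S.X 0 ω) := (hf.comp (comap_measurable _)).stronglyMeasurable
  have h := condExp_mul_of_stronglyMeasurable_right hfm
    ((hS.memLp_noise_mul w hf h2).integrable (by norm_num))
    ((hS.memLp_noise 0 w).integrable (by norm_num))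
  have h' := integral_condExp (μ := P) (f := fun ω => S.noise c β 0 w ω * f (S.X 0 ω)) hm
  have h0 : P[fun ω => S.noise c β 0 w ω * f (S.X 0 ω) |
      MeasurableSpace.comap (S.X 0) inferInstance] =ᵐ[P] fun _ => 0 := by
    refine h.trans ?_
    filter_upwards [hS.noise_mean 0 w] with ω hω
    simp [hω]
  rw [← h', integral_congr_ae h0]
  simp

lemma Homogeneous.integral_noise_sq (hS : Homogeneous S P c β σ) (w : Fin 2) :
    ∫ ω, S.noise c β 0 w ω ^ 2 ∂P = σ ^ 2 := by
  rw [← integral_condExp (hS.measurable_X 0).comap_le, integral_congr_ae (hS.condExp_noise_sq w)]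
  simp

lemma Homogeneous.memLp_coord (hS : Homogeneous S P c β σ) (a : Fin d) :
    MemLp (fun ω => S.X 0 ω a) 2 P :=
  memLp_pi_iff.1 (hS.memLp_X 0) a

end Moments

/-! ### Population regression, influence functions and their second moments -/

section Moments

variable {K d : ℕ} {Ω : Type*} [MeasurableSpace Ω] {P : Measure Ω} [IsProbabilityMeasure P]
  {S : Population K d Ω} {c : Fin 2 → ℝ} {β : Fin 2 → Fin d → ℝ} {σ : ℝ}

lemma measurable_aug (a : Fin (d + 1)) : Measurable fun x : Fin d → ℝ => aug x a := by
  refine Fin.cases ?_ (fun b => ?_) a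
  · simp [aug]
  · simpa [aug] using measurable_pi_apply b

lemma Homogeneous.memLp_aug (hS : Homogeneous S P c β σ) (a : Fin (d + 1)) :
    MemLp (fun ω => aug (S.X 0 ω) a) 2 P := by
  refine Fin.cases ?_ (fun b => ?_) a
  · simpa [aug] using memLp_const 1
  · simpa [aug] using hS.memLp_coord b

lemma Homogeneous.integrable_aug (hS : Homogeneous S P c β σ) (a : Fin (d + 1)) :
    Integrable (fun ω => aug (S.X 0 ω) a) P :=
  (hS.memLp_aug a).integrable (by norm_num)

/-- The mean of the augmented covariates. -/
def Population.meanAug (S : Population K d Ω) (P : Measure Ω) (a : Fin (d + 1)) : ℝ :=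
  ∫ ω, aug (S.X 0 ω) a ∂P

/-- The second moment matrix of the augmented covariates. -/
def Population.momentAug (S : Population K d Ω) (P : Measure Ω) :
    Matrix (Fin (d + 1)) (Fin (d + 1)) ℝ :=
  Matrix.of fun a b => ∫ ω, aug (S.X 0 ω) a * aug (S.X 0 ω) b ∂P

/-- The coefficients of the outcome regression of arm `w`, intercept first. -/
def thetaTrue (c : Fin 2 → ℝ) (β : Fin 2 → Fin d → ℝ) (w : Fin 2) : Fin (d + 1) → ℝ :=
  Fin.cons (c w) (β w)

lemma aug_dotProduct (x : Fin d → ℝ) (v : Fin (d + 1) → ℝ) :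
    aug x ⬝ᵥ v = v 0 + x ⬝ᵥ fun a => v a.succ := by
  simp [dotProduct, aug, Fin.sum_univ_succ]

lemma aug_dotProduct_thetaTrue (x : Fin d → ℝ) (w : Fin 2) :
    aug x ⬝ᵥ thetaTrue c β w = c w + x ⬝ᵥ β w := by
  simp [aug_dotProduct, thetaTrue]

lemma measurable_dotProduct_right (b : Fin d → ℝ) : Measurable fun x : Fin d → ℝ => x ⬝ᵥ b := by
  simp only [dotProduct]
  exact Finset.measurable_sum _ fun a _ => (measurable_pi_apply a).mul_const _

lemma Homogeneous.memLp_dotProduct (hS : Homogeneous S P c β σ) (b : Fin d → ℝ) :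
    MemLp (fun ω => S.X 0 ω ⬝ᵥ b) 2 P := by
  simp only [dotProduct]
  exact memLp_finsetSum _ fun a _ => (hS.memLp_coord a).mul_const _

lemma Homogeneous.variance_dotProduct (hS : Homogeneous S P c β σ) (b : Fin d → ℝ) :
    Var[fun ω => S.X 0 ω ⬝ᵥ b; P] = b ⬝ᵥ (S.covX P).mulVec b := by
  simp only [dotProduct, Matrix.mulVec, Population.covX, Matrix.of_apply]
  rw [variance_fun_sum fun a => (hS.memLp_coord a).mul_const (b a)]
  simp only [covariance_mul_const_left, covariance_mul_const_right, Finset.mul_sum]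
  exact Finset.sum_congr rfl fun _ _ => Finset.sum_congr rfl fun _ _ => by ring

lemma Population.momentAug_zero (S : Population K d Ω) (b : Fin (d + 1)) :
    S.momentAug P 0 b = S.meanAug P b := by
  simp [Population.momentAug, Population.meanAug, aug]

lemma Homogeneous.integrable_aug_mul (hS : Homogeneous S P c β σ) (a b : Fin (d + 1)) :
    Integrable (fun ω => aug (S.X 0 ω) a * aug (S.X 0 ω) b) P :=
  (hS.memLp_aug a).integrable_mul (hS.memLp_aug b)

lemma Homogeneous.dotProduct_momentAug (hS : Homogeneous S P c β σ) (v : Fin (d + 1) → ℝ) :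
    v ⬝ᵥ (S.momentAug P).mulVec v = ∫ ω, (aug (S.X 0 ω) ⬝ᵥ v) ^ 2 ∂P := by
  have h : ∀ ω, (aug (S.X 0 ω) ⬝ᵥ v) ^ 2 =
      ∑ a, ∑ b, v a * v b * (aug (S.X 0 ω) a * aug (S.X 0 ω) b) := fun ω => by
    rw [sq, dotProduct, Finset.sum_mul_sum]
    exact Finset.sum_congr rfl fun _ _ => Finset.sum_congr rfl fun _ _ => by ring
  simp_rw [h]
  rw [integral_finsetSum _ fun a _ => integrable_finsetSum _ fun b _ =>
    (hS.integrable_aug_mul a b).const_mul _]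
  simp only [dotProduct, Matrix.mulVec, Population.momentAug, Matrix.of_apply, Finset.mul_sum]
  refine Finset.sum_congr rfl fun a _ => ?_
  rw [integral_finsetSum _ fun b _ => (hS.integrable_aug_mul a b).const_mul _]
  refine Finset.sum_congr rfl fun b _ => ?_
  rw [integral_const_mul]
  ring

/-- The population regression with intercept has full rank. -/
lemma Homogeneous.det_momentAug_ne_zero (hS : Homogeneous S P c β σ) :
    (S.momentAug P).det ≠ 0 := by
  intro hdet
  -- A kernel vector v has E (X' v)² = 0, so X' v = 0 almost surely. Its slope part then gives a
  -- linear form in X of variance zero, so the slopes vanish by positive definiteness of Σ, and the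
  -- intercept vanishes with them.
  obtain ⟨v, hv0, hv⟩ := Matrix.exists_mulVec_eq_zero_iff.2 hdet
  have hsq := hS.dotProduct_momentAug v
  have hint : Integrable (fun ω => (aug (S.X 0 ω) ⬝ᵥ v) ^ 2) P := by
    have : MemLp (fun ω => aug (S.X 0 ω) ⬝ᵥ v) 2 P := by
      simp only [dotProduct]
      exact memLp_finsetSum _ fun a _ => (hS.memLp_aug a).mul_const _
    exact this.integrable_sq
  rw [hv, dotProduct_zero, eq_comm,
    integral_eq_zero_iff_of_nonneg (fun ω => sq_nonneg _) hint] at hsq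
  have hvar : Var[fun ω => S.X 0 ω ⬝ᵥ (fun a => v a.succ); P] = 0 := by
    rw [variance_congr (Y := fun _ => -v 0)]
    · rw [variance_eq_integral aemeasurable_const]
      simp
    filter_upwards [hsq] with ω hω
    have := pow_eq_zero_iff (two_ne_zero) |>.1 hω
    rw [aug_dotProduct] at this
    linarith
  have htail : (fun a : Fin d => v a.succ) = 0 := by
    by_contra hne
    have := hS.posDef_covX.dotProduct_mulVec_pos hne
    rw [hS.variance_dotProduct] at hvar
    simp only [star_trivial] at this
    exact this.ne' hvar
  apply hv0
  have h0 : v 0 = 0 := by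
    obtain ⟨ω, hω⟩ := hsq.exists
    have := pow_eq_zero_iff (two_ne_zero) |>.1 hω
    rwa [aug_dotProduct, htail, dotProduct_zero, add_zero] at this
  funext a
  exact Fin.cases h0 (fun b => congrFun htail b) a

/-- The intercept coordinate of X' is 1, so E X' is the first row of the moment matrix. This is why
the law of the covariates drops out of the noise part of the variances. -/
lemma Homogeneous.meanAug_vecMul_inv (hS : Homogeneous S P c β σ) :
    Matrix.vecMul (S.meanAug P) (S.momentAug P)⁻¹ = Pi.single 0 1 := by
  have h : S.meanAug P = Matrix.vecMul (Pi.single 0 1) (S.momentAug P) := by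
    funext b
    simp [Population.momentAug_zero]
  rw [h, Matrix.vecMul_vecMul, Matrix.mul_nonsing_inv _ hS.det_momentAug_ne_zero.isUnit,
    Matrix.vecMul_one]

/-- The centred individual treatment effect, as a function of the covariates. -/
def Population.effect (S : Population K d Ω) (P : Measure Ω) (β : Fin 2 → Fin d → ℝ)
    (x : Fin d → ℝ) : ℝ :=
  x ⬝ᵥ (β 1 - β 0) - ∫ ω, S.X 0 ω ⬝ᵥ (β 1 - β 0) ∂P

lemma Population.measurable_effect (S : Population K d Ω) : Measurable (S.effect P β) :=
  (measurable_dotProduct_right _).sub_const _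

lemma Homogeneous.memLp_effect (hS : Homogeneous S P c β σ) :
    MemLp (fun ω => S.effect P β (S.X 0 ω)) 2 P :=
  (hS.memLp_dotProduct _).sub (memLp_const _)

lemma Homogeneous.integral_effect (hS : Homogeneous S P c β σ) :
    ∫ ω, S.effect P β (S.X 0 ω) ∂P = 0 := by
  unfold Population.effect
  rw [integral_sub ((hS.memLp_dotProduct _).integrable (by norm_num)) (integrable_const _)]
  simp

lemma Homogeneous.integral_effect_sq (hS : Homogeneous S P c β σ) :
    ∫ ω, S.effect P β (S.X 0 ω) ^ 2 ∂P = S.effectSq P β := by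
  rw [Population.effectSq, ← hS.variance_dotProduct,
    variance_eq_integral (hS.memLp_dotProduct _).aemeasurable]
  rfl

lemma Homogeneous.ate_eq (hS : Homogeneous S P c β σ) :
    S.ate P = c 1 - c 0 + ∫ ω, S.X 0 ω ⬝ᵥ (β 1 - β 0) ∂P := by
  have h : ∀ ω, S.pot 0 1 ω - S.pot 0 0 ω =
      (S.noise c β 0 1 ω - S.noise c β 0 0 ω) + ((c 1 - c 0) + S.X 0 ω ⬝ᵥ (β 1 - β 0)) := by
    intro ω
    simp only [Population.noise, dotProduct_sub]
    ring
  have hn := fun w => (hS.memLp_noise 0 w).integrable (by norm_num)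
  unfold Population.ate
  simp_rw [h]
  have hd : Integrable (fun ω => S.X 0 ω ⬝ᵥ (β 1 - β 0)) P :=
    (hS.memLp_dotProduct _).integrable (by norm_num)
  have hsub : Integrable (fun ω => S.noise c β 0 1 ω - S.noise c β 0 0 ω) P := (hn 1).sub (hn 0)
  have hadd : Integrable (fun ω => (c 1 - c 0) + S.X 0 ω ⬝ᵥ (β 1 - β 0)) P :=
    (integrable_const _).add hd
  rw [integral_add hsub hadd, integral_sub (hn 1) (hn 0), integral_add (integrable_const _) hd,
    hS.integral_noise, hS.integral_noise]
  simp

lemma Homogeneous.aug_dotProduct_sub_ate (hS : Homogeneous S P c β σ) (x : Fin d → ℝ) :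
    aug x ⬝ᵥ thetaTrue c β 1 - aug x ⬝ᵥ thetaTrue c β 0 - S.ate P = S.effect P β x := by
  rw [aug_dotProduct_thetaTrue, aug_dotProduct_thetaTrue, hS.ate_eq, Population.effect,
    dotProduct_sub]
  ring

/-! ### Influence functions -/

/-- Residual of the outcome in arm `w`. -/
def residual (c : Fin 2 → ℝ) (β : Fin 2 → Fin d → ℝ) (w : Fin 2)
    (z : (Fin d → ℝ) × (Fin 2 → ℝ)) : ℝ :=
  z.2 w - (c w + z.1 ⬝ᵥ β w)

lemma measurable_residual (w : Fin 2) : Measurable (residual (d := d) c β w) := by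
  unfold residual
  exact ((measurable_pi_apply w).comp measurable_snd).sub
    (measurable_const.add ((measurable_dotProduct_right _).comp measurable_fst))

/-- The contribution of an individual to the normal equations of arm `w`, over the studies and
arms in `C`. -/
def score (c : Fin 2 → ℝ) (β : Fin 2 → Fin d → ℝ) (C : Finset (Fin K × Fin 2)) (w : Fin 2)
    (a : Fin (d + 1)) : Record K d → ℝ :=
  onRecord fun q z => if q ∈ C then residual c β w z * aug z.1 a else 0

/-- A combination of the noise in the arm received and of the centred treatment effect, with
coefficients depending on study and arm. -/
def effectInfluence (S : Population K d Ω) (P : Measure Ω) (c : Fin 2 → ℝ)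
    (β : Fin 2 → Fin d → ℝ) (α γ : Fin K × Fin 2 → ℝ) : Record K d → ℝ :=
  onRecord fun q z => α q * residual c β q.2 z + γ q * S.effect P β z.1

/-- Because the cell is independent of covariates and potential outcomes, centring and square
integrability may be checked for each cell separately, under the unconditional law. -/
lemma Homogeneous.hasInfluence_onRecord (hS : Homogeneous S P c β σ)
    {F : Fin K × Fin 2 → (Fin d → ℝ) × (Fin 2 → ℝ) → ℝ} (hF : ∀ q, Measurable (F q))
    (h2 : ∀ q, MemLp (fun ω => F q (S.X 0 ω, fun w => S.pot 0 w ω)) 2 P)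
    (h0 : ∀ q, ∫ ω, F q (S.X 0 ω, fun w => S.pot 0 w ω) ∂P = 0) :
    HasInfluence P S.record (rootSum S.record (onRecord F)) (onRecord F) := by
  refine hS.isIID.hasInfluence_rootSum (measurable_onRecord hF) (hS.memLp_onRecord h2) ?_
  rw [hS.integral_onRecord hF fun q => (h2 q).integrable (by norm_num)]
  simp [h0]

lemma Homogeneous.hasInfluence_score (hS : Homogeneous S P c β σ) (C : Finset (Fin K × Fin 2))
    (w : Fin 2) (a : Fin (d + 1)) :
    HasInfluence P S.record (rootSum S.record (score c β C w a)) (score c β C w a) := by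
  refine hS.hasInfluence_onRecord (fun q => ?_) (fun q => ?_) (fun q => ?_)
  · by_cases hq : q ∈ C
    · simp only [hq, if_true]
      exact (measurable_residual w).mul ((measurable_aug a).comp measurable_fst)
    · simp [hq]
  · by_cases hq : q ∈ C
    · simp only [hq, if_true]
      exact hS.memLp_noise_mul w (measurable_aug a) (hS.memLp_aug a)
    · simp [hq]
  · by_cases hq : q ∈ C
    · simp only [hq, if_true]
      exact hS.integral_noise_mul w (measurable_aug a) (hS.memLp_aug a)
    · simp [hq]

lemma Homogeneous.hasInfluence_effect (hS : Homogeneous S P c β σ)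
    (C : Finset (Fin K × Fin 2)) :
    HasInfluence P S.record
      (rootSum S.record (onRecord fun q z => if q ∈ C then S.effect P β z.1 else 0))
      (onRecord fun q z => if q ∈ C then S.effect P β z.1 else 0) := by
  refine hS.hasInfluence_onRecord (fun q => ?_) (fun q => ?_) (fun q => ?_)
  · by_cases hq : q ∈ C
    · simp only [hq, if_true]
      exact S.measurable_effect.comp measurable_fst
    · simp [hq]
  · by_cases hq : q ∈ C
    · simp only [hq, if_true]
      exact hS.memLp_effect
    · simp [hq]
  · by_cases hq : q ∈ C
    · simp only [hq, if_true]
      exact hS.integral_effect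
    · simp [hq]

/-- The cross term vanishes since the noise is orthogonal to square integrable functions of X; the
two squares have means σ² and ‖β⁽¹⁾ - β⁽⁰⁾‖²_Σ in every cell. -/
lemma Homogeneous.integral_effectInfluence_sq (hS : Homogeneous S P c β σ)
    (α γ : Fin K × Fin 2 → ℝ) :
    ∫ ω, effectInfluence S P c β α γ (S.record 0 ω) ^ 2 ∂P =
      ∑ q, S.pCell P q * (α q ^ 2 * σ ^ 2 + γ q ^ 2 * S.effectSq P β) := by
  have hsq : ∀ r, effectInfluence S P c β α γ r ^ 2 = onRecord (fun q z =>
      α q ^ 2 * residual c β q.2 z ^ 2 + (2 * α q * γ q) * (residual c β q.2 z * S.effect P β z.1)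
        + γ q ^ 2 * S.effect P β z.1 ^ 2) r := by
    intro r
    simp only [effectInfluence, onRecord]
    ring
  have h1 : ∀ w, Integrable (fun ω => residual c β w (S.X 0 ω, fun w => S.pot 0 w ω) ^ 2) P :=
    fun w => (hS.memLp_noise 0 w).integrable_sq
  have h2 : ∀ w, Integrable (fun ω => residual c β w (S.X 0 ω, fun w => S.pot 0 w ω) *
      S.effect P β (S.X 0 ω)) P := fun w =>
    (hS.memLp_noise_mul w S.measurable_effect hS.memLp_effect).integrable (by norm_num)
  have h3 := hS.memLp_effect.integrable_sq
  simp_rw [hsq]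
  have hm : Measurable fun z : (Fin d → ℝ) × (Fin 2 → ℝ) => S.effect P β z.1 :=
    S.measurable_effect.comp measurable_fst
  rw [hS.integral_onRecord]
  · refine Finset.sum_congr rfl fun q _ => ?_
    have h12 : Integrable (fun ω =>
        α q ^ 2 * residual c β q.2 (S.X 0 ω, fun w => S.pot 0 w ω) ^ 2 + (2 * α q * γ q) *
          (residual c β q.2 (S.X 0 ω, fun w => S.pot 0 w ω) * S.effect P β (S.X 0 ω))) P :=
      ((h1 q.2).const_mul _).add ((h2 q.2).const_mul _)
    rw [integral_add h12 (h3.const_mul _),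
      integral_add ((h1 q.2).const_mul _) ((h2 q.2).const_mul _), integral_const_mul,
      integral_const_mul, integral_const_mul, hS.integral_effect_sq]
    have e1 : ∫ ω, residual c β q.2 (S.X 0 ω, fun w => S.pot 0 w ω) ^ 2 ∂P = σ ^ 2 :=
      hS.integral_noise_sq q.2
    have e2 : ∫ ω, residual c β q.2 (S.X 0 ω, fun w => S.pot 0 w ω) *
        S.effect P β (S.X 0 ω) ∂P = 0 :=
      hS.integral_noise_mul q.2 S.measurable_effect hS.memLp_effect
    rw [e1, e2, mul_zero, add_zero]
  · intro q
    have := measurable_residual (c := c) (β := β) q.2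
    fun_prop
  · exact fun q => (((h1 q.2).const_mul _).add ((h2 q.2).const_mul _)).add (h3.const_mul _)

end Moments

/-! ### Measurability and continuity of the matrix inverse -/

section MatrixInverse

variable {Ω m : Type*} [MeasurableSpace Ω] [Fintype m] [DecidableEq m]

lemma measurable_det {A : Ω → Matrix m m ℝ} (hA : ∀ a b, Measurable fun ω => A ω a b) :
    Measurable fun ω => (A ω).det := by
  simp only [Matrix.det_apply']
  exact Finset.measurable_sum _ fun s _ => (Finset.measurable_prod _ fun i _ => hA _ _).const_mul _

/-- The formula by adjugate and inverse determinant holds for singular matrices too, with the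
convention 0⁻¹ = 0, so default values need no separate treatment. -/
lemma measurable_inv_apply {A : Ω → Matrix m m ℝ} (hA : ∀ a b, Measurable fun ω => A ω a b)
    (a b : m) : Measurable fun ω => (A ω)⁻¹ a b := by
  simp only [Matrix.inv_def, Matrix.smul_apply, Ring.inverse_eq_inv', smul_eq_mul,
    Matrix.adjugate_apply]
  refine (measurable_det hA).inv.mul (measurable_det fun i j => ?_)
  simp only [Matrix.updateRow_apply]
  split_ifs
  · exact measurable_const
  · exact hA i j

lemma tendsto_matrix_inv {ι : Type*} {l : Filter ι} {A : ι → Matrix m m ℝ} {B : Matrix m m ℝ}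
    (h : Tendsto A l (𝓝 B)) (hB : B.det ≠ 0) : Tendsto (fun i => (A i)⁻¹) l (𝓝 B⁻¹) := by
  simp only [Matrix.inv_def, Ring.inverse_eq_inv']
  have hdet : Tendsto (fun i => (A i).det) l (𝓝 B.det) :=
    ((continuous_id.matrix_det).tendsto B).comp h
  have hadj : Tendsto (fun i => (A i).adjugate) l (𝓝 B.adjugate) :=
    ((continuous_id.matrix_adjugate).tendsto B).comp h
  exact (hdet.inv₀ hB).smul hadj

end MatrixInverse

/-! ### Laws of large numbers and least squares over a set of cells -/

section Selection

variable {K d : ℕ} {Ω : Type*} [MeasurableSpace Ω] {P : Measure Ω} [IsProbabilityMeasure P]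
  {S : Population K d Ω} {c : Fin 2 → ℝ} {β : Fin 2 → Fin d → ℝ} {σ : ℝ}

/-- Observations whose study and arm belong to `C`. -/
def sel {n : ℕ} (D : Dataset K d n) (C : Finset (Fin K × Fin 2)) : Finset (Fin n) :=
  Finset.univ.filter fun i => ((D i).h, (D i).w) ∈ C

/-- The studies and arms of arm `w`. -/
def armCells (K : ℕ) (w : Fin 2) : Finset (Fin K × Fin 2) := Finset.univ.filter fun q => q.2 = w

/-- The studies and arms of study `k`. -/
def siteCells {K : ℕ} (k : Fin K) : Finset (Fin K × Fin 2) := Finset.univ.filter fun q => q.1 = k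

lemma arm_eq_sel {n : ℕ} (D : Dataset K d n) (w : Fin 2) : arm D w = sel D (armCells K w) := by
  simp [arm, sel, armCells]

lemma site_eq_sel {n : ℕ} (D : Dataset K d n) (k : Fin K) : site D k = sel D (siteCells k) := by
  simp [site, sel, siteCells]

lemma cell_eq_sel {n : ℕ} (D : Dataset K d n) (k : Fin K) (w : Fin 2) :
    cell D k w = sel D {(k, w)} := by
  simp [cell, sel]

lemma univ_eq_sel {n : ℕ} (D : Dataset K d n) : Finset.univ = sel D Finset.univ := by
  simp [sel]

/-- The probability that the study and arm of an individual belong to `C`. -/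
def Population.pSel (S : Population K d Ω) (P : Measure Ω) (C : Finset (Fin K × Fin 2)) : ℝ :=
  ∑ q ∈ C, S.pCell P q

/-- Moving the random index set into the summand gives a sum of i.i.d. terms over a fixed range,
which is the form used by the limit theorems. -/
lemma sum_sel (C : Finset (Fin K × Fin 2)) (F : Fin K × Fin 2 → (Fin d → ℝ) × (Fin 2 → ℝ) → ℝ)
    (n : ℕ) (ω : Ω) :
    ∑ i ∈ sel (S.data n ω) C, onRecord F (S.record i ω) = ∑ i ∈ Finset.range n,
      onRecord (fun q z => if q ∈ C then F q z else 0) (S.record i ω) := by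
  rw [sel, Finset.sum_filter, ← Fin.sum_univ_eq_sum_range
    (fun i => onRecord (fun q z => if q ∈ C then F q z else 0) (S.record i ω)) n]
  rfl

lemma Homogeneous.measurable_sum_sel (hS : Homogeneous S P c β σ) (C : Finset (Fin K × Fin 2))
    {F : Fin K × Fin 2 → (Fin d → ℝ) × (Fin 2 → ℝ) → ℝ} (hF : ∀ q, Measurable (F q)) (n : ℕ) :
    Measurable fun ω => ∑ i ∈ sel (S.data n ω) C, onRecord F (S.record i ω) := by
  simp_rw [sum_sel]
  refine Finset.measurable_sum _ fun i _ =>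
    (measurable_onRecord fun q => ?_).comp (hS.isIID.measurable i)
  split_ifs
  · exact hF q
  · exact measurable_const

lemma Homogeneous.measurable_sum_sel_x (hS : Homogeneous S P c β σ)
    (C : Finset (Fin K × Fin 2)) {F : (Fin d → ℝ) → ℝ} (hF : Measurable F) (n : ℕ) :
    Measurable fun ω => ∑ i ∈ sel (S.data n ω) C, F (S.data n ω i).x :=
  hS.measurable_sum_sel C (F := fun _ z => F z.1) (fun _ => hF.comp measurable_fst) n

lemma Homogeneous.measurable_card_sel (hS : Homogeneous S P c β σ)
    (C : Finset (Fin K × Fin 2)) (n : ℕ) :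
    Measurable fun ω => ((sel (S.data n ω) C).card : ℝ) := by
  simpa using hS.measurable_sum_sel_x C (F := fun _ => 1) measurable_const n

lemma Homogeneous.tendsto_sum_sel (hS : Homogeneous S P c β σ) (C : Finset (Fin K × Fin 2))
    {F : (Fin d → ℝ) → ℝ} (hF : Measurable F) (h1 : Integrable (fun ω => F (S.X 0 ω)) P) :
    ∀ᵐ ω ∂P, Tendsto (fun n : ℕ => (∑ i ∈ sel (S.data n ω) C, F (S.data n ω i).x) / (n : ℝ))
      atTop (𝓝 (S.pSel P C * ∫ ω, F (S.X 0 ω) ∂P)) := by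
  have hm : ∀ q, Measurable fun z : (Fin d → ℝ) × (Fin 2 → ℝ) => if q ∈ C then F z.1 else 0 := by
    intro q
    split_ifs
    · exact hF.comp measurable_fst
    · exact measurable_const
  have hi : ∀ q, Integrable (fun ω => if q ∈ C then F (S.X 0 ω) else 0) P := by
    intro q
    split_ifs
    · exact h1
    · exact integrable_const _
  have h2 : ∀ q, MemLp (fun ω => if q ∈ C then F (S.X 0 ω) else 0) 1 P :=
    fun q => memLp_one_iff_integrable.2 (hi q)
  have h := hS.isIID.strong_law (measurable_onRecord hm)
    (memLp_one_iff_integrable.1 (hS.memLp_onRecord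
      (F := fun q z => if q ∈ C then F z.1 else 0) h2))
  have hint : ∫ ω, onRecord (fun q z => if q ∈ C then F z.1 else 0) (S.record 0 ω) ∂P =
      S.pSel P C * ∫ ω, F (S.X 0 ω) ∂P := by
    rw [hS.integral_onRecord hm hi, Population.pSel, Finset.sum_mul,
      ← Finset.sum_filter_add_sum_filter_not Finset.univ (· ∈ C)]
    rw [Finset.sum_eq_zero (s := Finset.univ.filter (· ∉ C)), add_zero]
    · simp only [Finset.filter_univ_mem]
      exact Finset.sum_congr rfl fun q hq => by simp [hq]
    · intro q hq
      simp [(Finset.mem_filter.1 hq).2]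
  rw [hint] at h
  filter_upwards [h] with ω hω
  refine hω.congr fun n => ?_
  rw [← sum_sel C (fun _ z => F z.1)]
  rfl

lemma Homogeneous.tendsto_card_sel (hS : Homogeneous S P c β σ) (C : Finset (Fin K × Fin 2)) :
    ∀ᵐ ω ∂P, Tendsto (fun n : ℕ => ((sel (S.data n ω) C).card : ℝ) / n) atTop
      (𝓝 (S.pSel P C)) := by
  simpa using hS.tendsto_sum_sel C (F := fun _ => 1) measurable_const (integrable_const 1)

lemma Homogeneous.eventually_card_sel_pos (hS : Homogeneous S P c β σ)
    {C : Finset (Fin K × Fin 2)} (hC : 0 < S.pSel P C) :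
    ∀ᵐ ω ∂P, ∀ᶠ n : ℕ in atTop, 0 < ((sel (S.data n ω) C).card : ℝ) := by
  filter_upwards [hS.tendsto_card_sel C] with ω hω
  filter_upwards [hω.eventually_const_lt hC] with n hn
  by_contra h
  have : ((sel (S.data n ω) C).card : ℝ) = 0 := le_antisymm (not_lt.1 h) (by positivity)
  simp [this] at hn

lemma gram_apply {n : ℕ} (D : Dataset K d n) (s : Finset (Fin n)) (a b : Fin (d + 1)) :
    gram D s a b = ∑ i ∈ s, aug (D i).x a * aug (D i).x b := by
  simp [gram, Matrix.sum_apply, Matrix.vecMulVec_apply]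

lemma crossMoment_apply {n : ℕ} (D : Dataset K d n) (s : Finset (Fin n)) (a : Fin (d + 1)) :
    crossMoment D s a = ∑ i ∈ s, (D i).y * aug (D i).x a := by
  simp [crossMoment, Finset.sum_apply]

lemma Homogeneous.measurable_gram (hS : Homogeneous S P c β σ) (C : Finset (Fin K × Fin 2))
    (n : ℕ) (a b : Fin (d + 1)) :
    Measurable fun ω => gram (S.data n ω) (sel (S.data n ω) C) a b := by
  simp only [gram_apply]
  exact hS.measurable_sum_sel_x C ((measurable_aug a).mul (measurable_aug b)) n

lemma Homogeneous.measurable_crossMoment (hS : Homogeneous S P c β σ)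
    (C : Finset (Fin K × Fin 2)) (n : ℕ) (a : Fin (d + 1)) :
    Measurable fun ω => crossMoment (S.data n ω) (sel (S.data n ω) C) a := by
  simp only [crossMoment_apply]
  exact hS.measurable_sum_sel C (F := fun q z => z.2 q.2 * aug z.1 a) (fun q =>
    ((measurable_pi_apply q.2).comp measurable_snd).mul
      ((measurable_aug a).comp measurable_fst)) n

lemma Homogeneous.measurable_ols (hS : Homogeneous S P c β σ)
    (C : Finset (Fin K × Fin 2)) (n : ℕ) (a : Fin (d + 1)) :
    Measurable fun ω => ols (S.data n ω) (sel (S.data n ω) C) a := by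
  simp only [ols, Matrix.mulVec, dotProduct]
  exact Finset.measurable_sum _ fun b _ =>
    (measurable_inv_apply (hS.measurable_gram C n) a b).mul (hS.measurable_crossMoment C n b)

lemma Homogeneous.tendsto_gram (hS : Homogeneous S P c β σ) (C : Finset (Fin K × Fin 2)) :
    ∀ᵐ ω ∂P, Tendsto (fun n : ℕ => (n : ℝ)⁻¹ • gram (S.data n ω) (sel (S.data n ω) C)) atTop
      (𝓝 (S.pSel P C • S.momentAug P)) := by
  have h := fun a b => hS.tendsto_sum_sel C ((measurable_aug a).mul (measurable_aug b))
    (hS.integrable_aug_mul a b)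
  filter_upwards [ae_all_iff.2 fun a => ae_all_iff.2 fun b => h a b] with ω hω
  refine tendsto_pi_nhds.2 fun a => tendsto_pi_nhds.2 fun b => ?_
  refine (hω a b).congr fun n => ?_
  rw [Matrix.smul_apply, gram_apply, smul_eq_mul, div_eq_inv_mul]
  rfl

lemma Homogeneous.det_smul_momentAug_ne_zero (hS : Homogeneous S P c β σ)
    {C : Finset (Fin K × Fin 2)} (hC : 0 < S.pSel P C) :
    (S.pSel P C • S.momentAug P).det ≠ 0 := by
  rw [Matrix.det_smul]
  exact mul_ne_zero (pow_ne_zero _ hC.ne') hS.det_momentAug_ne_zero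

/-- Regressions over a set of studies and arms of positive probability are eventually of full
rank. -/
lemma Homogeneous.eventually_det_gram_ne_zero (hS : Homogeneous S P c β σ)
    {C : Finset (Fin K × Fin 2)} (hC : 0 < S.pSel P C) :
    ∀ᵐ ω ∂P, ∀ᶠ n : ℕ in atTop, (gram (S.data n ω) (sel (S.data n ω) C)).det ≠ 0 := by
  filter_upwards [hS.tendsto_gram C] with ω hω
  have hdet := ((continuous_id.matrix_det).tendsto (S.pSel P C • S.momentAug P)).comp hω
  filter_upwards [hdet.eventually_ne (hS.det_smul_momentAug_ne_zero hC)] with n hn h0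
  apply hn
  simp [h0]

lemma Homogeneous.tendsto_gram_inv (hS : Homogeneous S P c β σ)
    {C : Finset (Fin K × Fin 2)} (hC : 0 < S.pSel P C) (a b : Fin (d + 1)) :
    ∀ᵐ ω ∂P, Tendsto (fun n : ℕ => ((n : ℝ)⁻¹ • gram (S.data n ω) (sel (S.data n ω) C))⁻¹ a b)
      atTop (𝓝 ((S.pSel P C)⁻¹ * (S.momentAug P)⁻¹ a b)) := by
  filter_upwards [hS.tendsto_gram C] with ω hω
  have h := tendsto_matrix_inv hω (hS.det_smul_momentAug_ne_zero hC)
  have hinv : (S.pSel P C • S.momentAug P)⁻¹ = (S.pSel P C)⁻¹ • (S.momentAug P)⁻¹ := by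
    have := invertibleOfNonzero hC.ne'
    rw [Matrix.inv_smul _ _ hS.det_momentAug_ne_zero.isUnit, invOf_eq_inv]
  rw [hinv] at h
  exact tendsto_pi_nhds.1 (tendsto_pi_nhds.1 h a) b

/-- The influence function of the least squares estimator of arm `w` over `C`. -/
def olsInfluence (S : Population K d Ω) (P : Measure Ω) (c : Fin 2 → ℝ)
    (β : Fin 2 → Fin d → ℝ) (C : Finset (Fin K × Fin 2)) (w : Fin 2) (a : Fin (d + 1))
    (r : Record K d) : ℝ :=
  ∑ b, ((S.pSel P C)⁻¹ * (S.momentAug P)⁻¹ a b) * score c β C w b r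

/-- As C lies in arm w, the observed outcomes are those potential in arm w, and the normal equations
at the true coefficients leave only noise times covariates. -/
lemma crossMoment_sub_gram {C : Finset (Fin K × Fin 2)} {w : Fin 2} (hC : ∀ q ∈ C, q.2 = w)
    (n : ℕ) (ω : Ω) (b : Fin (d + 1)) :
    (crossMoment (S.data n ω) (sel (S.data n ω) C) -
      (gram (S.data n ω) (sel (S.data n ω) C)).mulVec (thetaTrue c β w)) b =
      ∑ i ∈ Finset.range n, score c β C w b (S.record i ω) := by
  have h : ∀ i ∈ sel (S.data n ω) C, ((S.data n ω i).y - aug (S.data n ω i).x ⬝ᵥ thetaTrue c β w) *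
      aug (S.data n ω i).x b =
      onRecord (fun _ z => residual c β w z * aug z.1 b) (S.record i ω) := by
    intro i hi
    have hw : S.W i ω = w := hC _ (Finset.mem_filter.1 hi).2
    rw [aug_dotProduct_thetaTrue]
    simp only [Population.data, onRecord, Population.record, residual, hw]
  have h2 := sum_sel (S := S) C (fun _ z => residual c β w z * aug z.1 b) n ω
  rw [← Finset.sum_congr rfl h] at h2
  rw [Pi.sub_apply, crossMoment_apply, Matrix.mulVec, dotProduct]
  simp only [gram_apply, Finset.sum_mul]
  rw [Finset.sum_comm, ← Finset.sum_sub_distrib]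
  refine Eq.trans (Finset.sum_congr rfl fun i _ => ?_) h2
  rw [sub_mul, dotProduct, Finset.sum_mul]
  congr 1
  exact Finset.sum_congr rfl fun _ _ => by ring

/-- An exact identity and not an expansion: with a converging matrix in front of normalised sums,
asymptotic linearity becomes a Slutsky argument. -/
lemma sqrt_mul_ols_sub {C : Finset (Fin K × Fin 2)} {w : Fin 2} (hC : ∀ q ∈ C, q.2 = w)
    {n : ℕ} (hn : 0 < n) {ω : Ω} (hdet : (gram (S.data n ω) (sel (S.data n ω) C)).det ≠ 0)
    (a : Fin (d + 1)) :
    √(n : ℝ) * (ols (S.data n ω) (sel (S.data n ω) C) a - thetaTrue c β w a) =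
      ∑ b, ((n : ℝ)⁻¹ • gram (S.data n ω) (sel (S.data n ω) C))⁻¹ a b *
        rootSum S.record (score c β C w b) n ω := by
  have hn' : (0 : ℝ) < n := by exact_mod_cast hn
  set G := gram (S.data n ω) (sel (S.data n ω) C) with hG
  have hols : ols (S.data n ω) (sel (S.data n ω) C) - thetaTrue c β w =
      G⁻¹.mulVec (crossMoment (S.data n ω) (sel (S.data n ω) C) -
        G.mulVec (thetaTrue c β w)) := by
    rw [Matrix.mulVec_sub, Matrix.mulVec_mulVec, Matrix.nonsing_inv_mul _ hdet.isUnit,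
      Matrix.one_mulVec, ols]
  have hinv : ((n : ℝ)⁻¹ • G)⁻¹ = (n : ℝ) • G⁻¹ := by
    have := invertibleOfNonzero (inv_ne_zero hn'.ne')
    rw [Matrix.inv_smul _ _ hdet.isUnit, invOf_eq_inv, inv_inv]
  rw [← Pi.sub_apply, hols, hinv, Matrix.mulVec, dotProduct, Finset.mul_sum]
  refine Finset.sum_congr rfl fun b _ => ?_
  rw [crossMoment_sub_gram hC, Matrix.smul_apply, rootSum, smul_eq_mul]
  have hs : √(n : ℝ) = n * (√(n : ℝ))⁻¹ := by
    rw [eq_mul_inv_iff_mul_eq₀ (Real.sqrt_pos.2 hn').ne', Real.mul_self_sqrt hn'.le]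
  nth_rewrite 1 [hs]
  ring

/-- The least squares estimator is asymptotically linear. -/
lemma Homogeneous.hasInfluence_ols (hS : Homogeneous S P c β σ) {C : Finset (Fin K × Fin 2)}
    {w : Fin 2} (hC : ∀ q ∈ C, q.2 = w) (hp : 0 < S.pSel P C) (a : Fin (d + 1)) :
    HasInfluence P S.record (fun n ω => √(n : ℝ) *
      (ols (S.data n ω) (sel (S.data n ω) C) a - thetaTrue c β w a))
      (olsInfluence S P c β C w a) := by
  have h := hS.isIID.hasInfluence_sum Finset.univ fun b _ =>
    (hS.hasInfluence_score C w b).mul hS.isIID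
      (B := fun n ω => ((n : ℝ)⁻¹ • gram (S.data n ω) (sel (S.data n ω) C))⁻¹ a b)
      (fun n => (measurable_inv_apply (fun i j =>
        (hS.measurable_gram C n i j).const_smul ((n : ℝ)⁻¹)) a b).aemeasurable)
      (hS.tendsto_gram_inv hp a b)
  refine h.congr (fun n => (((hS.measurable_ols C n a).sub_const _).const_mul _).aemeasurable) ?_
  filter_upwards [hS.eventually_det_gram_ne_zero hp] with ω hω
  filter_upwards [hω, eventually_gt_atTop 0] with n hn hn0
  exact sqrt_mul_ols_sub hC hn0 hn a

end Selection

/-! ### Cell probabilities and asymptotics of the outcome parameters -/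

section Estimation

variable {K d : ℕ} {Ω : Type*} [MeasurableSpace Ω] {P : Measure Ω} [IsProbabilityMeasure P]
  {S : Population K d Ω} {c : Fin 2 → ℝ} {β : Fin 2 → Fin d → ℝ} {σ : ℝ}

lemma Homogeneous.pSel_eq (hS : Homogeneous S P c β σ) (C : Finset (Fin K × Fin 2)) :
    S.pSel P C = P.real ((fun ω => (S.H 0 ω, S.W 0 ω)) ⁻¹' C) :=
  sum_measureReal_preimage_singleton C fun q _ =>
    (measurableSet_singleton q).preimage ((hS.measurable_H 0).prodMk (hS.measurable_W 0))

lemma Homogeneous.pSel_siteCells (hS : Homogeneous S P c β σ) (k : Fin K) :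
    S.pSel P (siteCells k) = S.rho P k := by
  rw [hS.pSel_eq, Population.rho]
  congr 1
  ext ω
  simp [siteCells]

lemma Homogeneous.pSel_armCells_one (hS : Homogeneous S P c β σ) :
    S.pSel P (armCells K 1) = S.pTreat P := by
  rw [hS.pSel_eq, Population.pTreat]
  congr 1
  ext ω
  simp [armCells]

lemma Homogeneous.pSel_univ (hS : Homogeneous S P c β σ) : S.pSel P Finset.univ = 1 := by
  rw [hS.pSel_eq]
  simp

lemma sum_siteCells (k : Fin K) (f : Fin K × Fin 2 → ℝ) :
    ∑ q ∈ siteCells k, f q = f (k, 0) + f (k, 1) := by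
  have : siteCells k = {(k, 0), (k, 1)} := by
    ext ⟨j, w⟩
    fin_cases w <;> simp [siteCells]
  rw [this, Finset.sum_pair (by simp)]

lemma sum_armCells (w : Fin 2) (f : Fin K × Fin 2 → ℝ) :
    ∑ q ∈ armCells K w, f q = ∑ k, f (k, w) := by
  rw [armCells, Finset.sum_filter, Fintype.sum_prod_type]
  simp

lemma Homogeneous.pCell_one (hS : Homogeneous S P c β σ) (k : Fin K) :
    S.pCell P (k, 1) = S.rho P k * S.pStudy P k := by
  have hk := hS.rho_pos k
  rw [Population.pStudy, measureReal_def, cond_apply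
    ((measurableSet_singleton k).preimage (hS.measurable_H 0)), Population.pCell,
    ENNReal.toReal_mul, ENNReal.toReal_inv]
  change _ = S.rho P k * ((S.rho P k)⁻¹ * P.real _)
  rw [mul_inv_cancel_left₀ hk.ne']
  congr 1
  ext ω
  simp

lemma Homogeneous.pCell_zero (hS : Homogeneous S P c β σ) (k : Fin K) :
    S.pCell P (k, 0) = S.rho P k * (1 - S.pStudy P k) := by
  have h := hS.pSel_siteCells k
  rw [Population.pSel, sum_siteCells, hS.pCell_one] at h
  linarith

lemma Homogeneous.pCell_pos (hS : Homogeneous S P c β σ) (q : Fin K × Fin 2) :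
    0 < S.pCell P q := by
  obtain ⟨k, w⟩ := q
  have h := hS.pStudy_mem k
  fin_cases w
  · have := hS.pCell_zero k
    simp only [Fin.zero_eta, this]
    exact mul_pos (hS.rho_pos k) (by linarith [h.2])
  · have := hS.pCell_one k
    simp only [Fin.mk_one, this]
    exact mul_pos (hS.rho_pos k) h.1

lemma Homogeneous.pSel_pos (hS : Homogeneous S P c β σ) {C : Finset (Fin K × Fin 2)}
    (hC : C.Nonempty) : 0 < S.pSel P C :=
  Finset.sum_pos (fun q _ => hS.pCell_pos q) hC

lemma Homogeneous.sum_rho (hS : Homogeneous S P c β σ) : ∑ k, S.rho P k = 1 := by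
  rw [← hS.pSel_univ, Population.pSel, Fintype.sum_prod_type]
  refine Finset.sum_congr rfl fun k _ => ?_
  rw [← hS.pSel_siteCells, Population.pSel, sum_siteCells, Fin.sum_univ_two]

lemma Homogeneous.pTreat_eq (hS : Homogeneous S P c β σ) :
    S.pTreat P = ∑ k, S.rho P k * S.pStudy P k := by
  rw [← hS.pSel_armCells_one, Population.pSel, sum_armCells]
  exact Finset.sum_congr rfl fun k _ => hS.pCell_one k

lemma Homogeneous.pSel_armCells_zero (hS : Homogeneous S P c β σ) :
    S.pSel P (armCells K 0) = 1 - S.pTreat P := by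
  rw [Population.pSel, sum_armCells, hS.pTreat_eq, ← hS.sum_rho, ← Finset.sum_sub_distrib]
  refine Finset.sum_congr rfl fun k _ => ?_
  rw [hS.pCell_zero]
  ring

lemma Homogeneous.nonempty_study (hS : Homogeneous S P c β σ) : Nonempty (Fin K) := by
  by_contra h
  rw [not_nonempty_iff] at h
  simpa using hS.sum_rho

lemma Homogeneous.armCells_nonempty (hS : Homogeneous S P c β σ) (w : Fin 2) :
    (armCells K w).Nonempty := by
  obtain ⟨k⟩ := hS.nonempty_study
  exact ⟨(k, w), by simp [armCells]⟩

lemma siteCells_nonempty (k : Fin K) : (siteCells k).Nonempty := ⟨(k, 0), by simp [siteCells]⟩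

lemma card_sel_eq_sum {n : ℕ} (D : Dataset K d n) (C : Finset (Fin K × Fin 2)) :
    (sel D C).card = ∑ q ∈ C, (sel D {q}).card := by
  have h : sel D C = C.biUnion fun q => sel D {q} := by
    ext i
    simp [sel]
  rw [h, Finset.card_biUnion]
  · intro q _ q' _ hne
    refine Finset.disjoint_left.2 fun i hi hi' => hne ?_
    simp only [sel, Finset.mem_filter, Finset.mem_singleton] at hi hi'
    exact hi.2.symm.trans hi'.2

lemma card_arm_eq_sum {n : ℕ} (D : Dataset K d n) (w : Fin 2) :
    ((arm D w).card : ℝ) = ∑ k, ((cell D k w).card : ℝ) := by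
  simp only [arm_eq_sel, cell_eq_sel]
  rw [card_sel_eq_sum, Nat.cast_sum, sum_armCells w fun q => ((sel D {q}).card : ℝ)]

lemma sum_card_site {n : ℕ} (D : Dataset K d n) : ∑ k, ((site D k).card : ℝ) = n := by
  have h := Finset.card_eq_sum_card_fiberwise (s := (Finset.univ : Finset (Fin n)))
    (t := Finset.univ) (f := fun i => (D i).h) (by simp)
  rw [Finset.card_univ, Fintype.card_fin] at h
  exact_mod_cast h.symm

/-- The sample-size aggregation of the study-level plug-in estimators with common outcome
parameters is the plug-in estimator over all the data. -/
lemma swAggregate_gFormula {n : ℕ} (D : Dataset K d n) (θ : Fin 2 → Fin (d + 1) → ℝ) :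
    swAggregate D (fun k => gFormula D (site D k) θ) = gFormula D Finset.univ θ := by
  simp only [swAggregate, gFormula, Finset.card_univ, Fintype.card_fin]
  rw [← Finset.sum_fiberwise Finset.univ (fun i => (D i).h), Finset.mul_sum]
  refine Finset.sum_congr rfl fun k _ => ?_
  change _ = _ * ∑ i ∈ site D k, _
  rcases eq_or_ne ((site D k).card : ℝ) 0 with h | h
  · have : site D k = ∅ := by simpa using h
    simp [this]
  · field_simp

/-- Together with the limits of the weights, this additivity makes the weighted local regressions
equivalent to the pooled one. -/
lemma score_arm (c : Fin 2 → ℝ) (β : Fin 2 → Fin d → ℝ) (w : Fin 2) (a : Fin (d + 1))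
    (r : Record K d) : score c β (armCells K w) w a r = ∑ k, score c β {(k, w)} w a r := by
  obtain ⟨x, w', h, y⟩ := r
  by_cases hw : w' = w
  · simp [score, onRecord, armCells, hw]
  · simp [score, onRecord, armCells, hw]

lemma Homogeneous.hasInfluence_thetaPool (hS : Homogeneous S P c β σ) (w : Fin 2)
    (a : Fin (d + 1)) :
    HasInfluence P S.record (fun n ω => √(n : ℝ) *
      (thetaPool (S.data n ω) w a - thetaTrue c β w a))
      (olsInfluence S P c β (armCells K w) w a) := by
  simp only [thetaPool, arm_eq_sel]
  exact hS.hasInfluence_ols (fun q hq => (Finset.mem_filter.1 hq).2)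
    (hS.pSel_pos (hS.armCells_nonempty w)) a

lemma Homogeneous.measurable_thetaPool (hS : Homogeneous S P c β σ) (w : Fin 2)
    (a : Fin (d + 1)) (n : ℕ) : Measurable fun ω => thetaPool (S.data n ω) w a := by
  simp only [thetaPool, arm_eq_sel]
  exact hS.measurable_ols _ n a

lemma Homogeneous.measurable_thetaLocal (hS : Homogeneous S P c β σ) (k : Fin K) (w : Fin 2)
    (a : Fin (d + 1)) (n : ℕ) : Measurable fun ω => thetaLocal (S.data n ω) k w a := by
  simp only [thetaLocal, cell_eq_sel]
  exact hS.measurable_ols _ n a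

lemma Homogeneous.hasInfluence_thetaLocal (hS : Homogeneous S P c β σ) (k : Fin K) (w : Fin 2)
    (a : Fin (d + 1)) :
    HasInfluence P S.record (fun n ω => √(n : ℝ) *
      (thetaLocal (S.data n ω) k w a - thetaTrue c β w a))
      (olsInfluence S P c β {(k, w)} w a) := by
  simp only [thetaLocal, cell_eq_sel]
  exact hS.hasInfluence_ols (by simp) (hS.pSel_pos (Finset.singleton_nonempty _)) a

lemma theta1SSW_apply {n : ℕ} (D : Dataset K d n) (w : Fin 2) (a : Fin (d + 1)) :
    theta1SSW D w a = ∑ k, ((cell D k w).card : ℝ) / (arm D w).card * thetaLocal D k w a := by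
  simp [theta1SSW, Finset.sum_apply]

lemma Homogeneous.measurable_cellShare (hS : Homogeneous S P c β σ) (k : Fin K) (w : Fin 2)
    (n : ℕ) : Measurable fun ω =>
      ((cell (S.data n ω) k w).card : ℝ) / (arm (S.data n ω) w).card := by
  simp only [cell_eq_sel, arm_eq_sel]
  exact (hS.measurable_card_sel _ n).div (hS.measurable_card_sel _ n)

/-- Sample-size weighting of the local regressions is asymptotically equivalent to the pooled
regression. -/
lemma Homogeneous.hasInfluence_theta1SSW (hS : Homogeneous S P c β σ) (w : Fin 2)
    (a : Fin (d + 1)) :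
    HasInfluence P S.record (fun n ω => √(n : ℝ) *
      (theta1SSW (S.data n ω) w a - thetaTrue c β w a))
      (olsInfluence S P c β (armCells K w) w a) := by
  have hw := hS.pSel_pos (hS.armCells_nonempty w)
  have hlim : ∀ k, ∀ᵐ ω ∂P, Tendsto (fun n : ℕ =>
      ((cell (S.data n ω) k w).card : ℝ) / (arm (S.data n ω) w).card) atTop
      (𝓝 (S.pSel P {(k, w)} / S.pSel P (armCells K w))) := by
    intro k
    filter_upwards [hS.tendsto_card_sel {(k, w)}, hS.tendsto_card_sel (armCells K w)] with ω h1 h2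
    refine (h1.div h2 hw.ne').congr' ?_
    filter_upwards [eventually_gt_atTop 0] with n hn
    have : (n : ℝ) ≠ 0 := by exact_mod_cast hn.ne'
    rw [cell_eq_sel, arm_eq_sel, Pi.div_apply, div_div_div_cancel_right₀ this]
  have h := hS.isIID.hasInfluence_sum Finset.univ fun k _ =>
    (hS.hasInfluence_thetaLocal k w a).mul hS.isIID
      (fun n => (hS.measurable_cellShare k w n).aemeasurable) (hlim k)
  -- The limiting weight P(k, w) / P(w) cancels the factor 1 / P(k, w) of the local regression. The
  -- matrix M is common to all studies, so the local scores add up to the pooled score.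
  have hinf : (fun r => ∑ k, S.pSel P {(k, w)} / S.pSel P (armCells K w) *
      olsInfluence S P c β {(k, w)} w a r) = olsInfluence S P c β (armCells K w) w a := by
    funext r
    simp only [olsInfluence, score_arm, Finset.mul_sum]
    rw [Finset.sum_comm]
    refine Finset.sum_congr rfl fun b _ => Finset.sum_congr rfl fun k _ => ?_
    have hk := (hS.pSel_pos (Finset.singleton_nonempty (k, w))).ne'
    field_simp
  rw [hinf] at h
  refine h.congr (fun n => ?_) ?_
  · simp only [theta1SSW_apply]
    exact (((Finset.measurable_sum _ fun k _ => (hS.measurable_cellShare k w n).mul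
      (hS.measurable_thetaLocal k w a n)).sub_const _).const_mul _).aemeasurable
  · filter_upwards [hS.eventually_card_sel_pos hw] with ω hω
    filter_upwards [hω] with n hn
    rw [← arm_eq_sel] at hn
    -- Weights summing to one allow the true coefficient to be subtracted from each local estimate,
    -- so fluctuations of the weights have no first-order effect.
    have hsum : ∑ k, ((cell (S.data n ω) k w).card : ℝ) / (arm (S.data n ω) w).card = 1 := by
      rw [← Finset.sum_div, ← card_arm_eq_sum, div_self hn.ne']
    rw [theta1SSW_apply]
    calc _ = √(n : ℝ) * (∑ k, ((cell (S.data n ω) k w).card : ℝ) / (arm (S.data n ω) w).card *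
          thetaLocal (S.data n ω) k w a - (∑ k, ((cell (S.data n ω) k w).card : ℝ) /
            (arm (S.data n ω) w).card) * thetaTrue c β w a) := by rw [hsum, one_mul]
      _ = _ := by
        rw [Finset.sum_mul, ← Finset.sum_sub_distrib, Finset.mul_sum]
        exact Finset.sum_congr rfl fun k _ => by ring

lemma gram_arm {n : ℕ} (D : Dataset K d n) (w : Fin 2) :
    gram D (arm D w) = ∑ k, gram D (cell D k w) := by
  have h : ∀ k, cell D k w = (arm D w).filter fun i => (D i).h = k := by
    intro k
    ext i
    simp [cell, arm, and_comm]
  simp only [gram, h]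
  exact (Finset.sum_fiberwise _ _ _).symm

lemma crossMoment_arm {n : ℕ} (D : Dataset K d n) (w : Fin 2) :
    crossMoment D (arm D w) = ∑ k, crossMoment D (cell D k w) := by
  have h : ∀ k, cell D k w = (arm D w).filter fun i => (D i).h = k := by
    intro k
    ext i
    simp [cell, arm, and_comm]
  simp only [crossMoment, h]
  exact (Finset.sum_fiberwise _ _ _).symm

/-- Inverse-variance weighting of the local regressions gives the pooled regression when all the
regressions have full rank. -/
lemma theta1SIVW_eq_thetaPool {n : ℕ} (D : Dataset K d n) (w : Fin 2) (hσ : 0 < σ)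
    (hk : ∀ k, (gram D (cell D k w)).det ≠ 0) (hw : (gram D (arm D w)).det ≠ 0) :
    theta1SIVW σ D w = thetaPool D w := by
  have hs : (σ ^ 2)⁻¹ ≠ 0 := by positivity
  have h : ∀ k, (((σ ^ 2)⁻¹ • gram D (cell D k w)).mulVec (thetaLocal D k w)) =
      (σ ^ 2)⁻¹ • crossMoment D (cell D k w) := by
    intro k
    rw [thetaLocal, ols, Matrix.smul_mulVec, Matrix.mulVec_mulVec,
      Matrix.mul_nonsing_inv _ (hk k).isUnit, Matrix.one_mulVec]
  have := invertibleOfNonzero hs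
  rw [theta1SIVW]
  simp only [h]
  rw [← Finset.smul_sum, ← Finset.smul_sum, ← gram_arm, ← crossMoment_arm,
    Matrix.inv_smul _ _ hw.isUnit, Matrix.smul_mulVec, Matrix.mulVec_smul, smul_smul,
    invOf_mul_self, one_smul]
  rfl

lemma Homogeneous.measurable_theta1SIVW (hS : Homogeneous S P c β σ) (w : Fin 2)
    (a : Fin (d + 1)) (n : ℕ) : Measurable fun ω => theta1SIVW σ (S.data n ω) w a := by
  simp only [theta1SIVW, Matrix.mulVec, dotProduct, Finset.sum_apply]
  have hg : ∀ k i j, Measurable fun ω =>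
      ((σ ^ 2)⁻¹ • gram (S.data n ω) (cell (S.data n ω) k w)) i j := by
    intro k i j
    simp only [cell_eq_sel]
    exact (hS.measurable_gram {(k, w)} n i j).const_smul ((σ ^ 2)⁻¹)
  refine Finset.measurable_sum _ fun b _ => (measurable_inv_apply (fun i j => ?_) a b).mul
    (Finset.measurable_sum _ fun k _ => Finset.measurable_sum _ fun j _ =>
      (hg k b j).mul (hS.measurable_thetaLocal k w j n))
  simp only [Matrix.sum_apply]
  exact Finset.measurable_sum _ fun k _ => hg k i j

lemma Homogeneous.hasInfluence_theta1SIVW (hS : Homogeneous S P c β σ) (w : Fin 2)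
    (a : Fin (d + 1)) :
    HasInfluence P S.record (fun n ω => √(n : ℝ) *
      (theta1SIVW σ (S.data n ω) w a - thetaTrue c β w a))
      (olsInfluence S P c β (armCells K w) w a) := by
  refine (hS.hasInfluence_thetaPool w a).congr
    (fun n => (((hS.measurable_theta1SIVW w a n).sub_const _).const_mul _).aemeasurable) ?_
  filter_upwards [hS.eventually_det_gram_ne_zero (hS.pSel_pos (hS.armCells_nonempty w)),
    ae_all_iff.2 fun k => hS.eventually_det_gram_ne_zero
      (hS.pSel_pos (Finset.singleton_nonempty (k, w)))] with ω h1 h2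
  filter_upwards [h1, eventually_all.2 h2] with n hn1 hn2
  rw [theta1SIVW_eq_thetaPool _ _ hS.sigma_pos]
  · simpa only [cell_eq_sel] using hn2
  · simpa only [arm_eq_sel] using hn1

lemma fullRank_iff {n : ℕ} (D : Dataset K d n) (s : Finset (Fin n)) :
    FullRank D s ↔ (gram D s).det ≠ 0 := by
  constructor
  · intro h
    have hr : LinearMap.range (gram D s).mulVecLin = ⊤ := by
      refine Submodule.eq_top_of_finrank_eq ?_
      rw [Module.finrank_fin_fun]
      exact h
    have := Matrix.mulVec_surjective_iff_isUnit.1 (LinearMap.range_eq_top.1 hr)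
    exact ((Matrix.isUnit_iff_isUnit_det _).1 this).ne_zero
  · intro h
    have := Matrix.rank_of_isUnit _ ((Matrix.isUnit_iff_isUnit_det _).2 h.isUnit)
    rwa [Fintype.card_fin] at this

-- The limit is replaced by an explicit measurable function of the data. No measurability of the
-- rule choosing the FedAvg parameters is then required.
open Classical in
lemma FedAvgRule.Tuned.thetaGD_eq {a : FedAvgRule K d} (ha : a.Tuned) {n : ℕ}
    (D : Dataset K d n) (w : Fin 2) :
    thetaGD a D w = if (gram D (arm D w)).det ≠ 0 then thetaPool D w else 0 := by
  rw [thetaGD]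
  by_cases h : FullRank D (arm D w)
  · rw [if_pos h, if_pos ((fullRank_iff D _).1 h), (ha n D w h).limUnder_eq]
  · rw [if_neg h, if_neg (mt (fullRank_iff D _).2 h)]

lemma Homogeneous.hasInfluence_thetaGD (hS : Homogeneous S P c β σ) {r : FedAvgRule K d}
    (hr : r.Tuned) (w : Fin 2) (a : Fin (d + 1)) :
    HasInfluence P S.record (fun n ω => √(n : ℝ) *
      (thetaGD r (S.data n ω) w a - thetaTrue c β w a))
      (olsInfluence S P c β (armCells K w) w a) := by
  classical
  refine (hS.hasInfluence_thetaPool w a).congr (fun n => Measurable.aemeasurable ?_) ?_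
  · have h : ∀ ω, thetaGD r (S.data n ω) w a =
        if (gram (S.data n ω) (sel (S.data n ω) (armCells K w))).det ≠ 0 then
          thetaPool (S.data n ω) w a else 0 := by
      intro ω
      rw [hr.thetaGD_eq, arm_eq_sel]
      split_ifs <;> rfl
    simp only [h]
    refine ((Measurable.ite ?_ (hS.measurable_thetaPool w a n) measurable_const).sub_const
      _).const_mul _
    exact (measurable_det (hS.measurable_gram (armCells K w) n)) (measurableSet_singleton 0).compl
  · filter_upwards [hS.eventually_det_gram_ne_zero
      (hS.pSel_pos (hS.armCells_nonempty w))] with ω hω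
    filter_upwards [hω] with n hn
    rw [← arm_eq_sel] at hn
    rw [hr.thetaGD_eq, if_pos hn]

end Estimation

/-! ### Influence functions and variances of the effect estimators -/

section Effects

variable {K d : ℕ} {Ω : Type*} [MeasurableSpace Ω] {P : Measure Ω} [IsProbabilityMeasure P]
  {S : Population K d Ω} {c : Fin 2 → ℝ} {β : Fin 2 → Fin d → ℝ} {σ : ℝ}

/-- The sign with which an arm enters the treatment effect. -/
def armSign : Fin 2 → ℝ := ![-1, 1]

lemma armSign_sq (w : Fin 2) : armSign w ^ 2 = 1 := by
  fin_cases w <;> simp [armSign]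

/-- Contraction with E X' cancels M⁻¹ up to the first unit vector, so only the intercept score,
which is the noise itself, survives. -/
lemma Homogeneous.sum_meanAug_olsInfluence (hS : Homogeneous S P c β σ)
    (C : Finset (Fin K × Fin 2)) (w : Fin 2) (r : Record K d) :
    ∑ a, S.meanAug P a * olsInfluence S P c β C w a r = (S.pSel P C)⁻¹ * score c β C w 0 r := by
  have h : ∀ b, ∑ a, S.meanAug P a * (S.momentAug P)⁻¹ a b =
      (Pi.single 0 1 : Fin (d + 1) → ℝ) b := fun b => by
    rw [← hS.meanAug_vecMul_inv]
    rfl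
  simp only [olsInfluence, Finset.mul_sum]
  rw [Finset.sum_comm]
  calc _ = ∑ b, (S.pSel P C)⁻¹ * (∑ a, S.meanAug P a * (S.momentAug P)⁻¹ a b) *
        score c β C w b r := by
        refine Finset.sum_congr rfl fun b _ => ?_
        rw [Finset.mul_sum, Finset.sum_mul]
        exact Finset.sum_congr rfl fun a _ => by ring
    _ = _ := by
        simp only [h]
        rw [Finset.sum_eq_single 0]
        · simp
        · intro b _ hb
          simp [hb]
        · simp

/-- Separates the error of the parameters, weighted by the empirical mean of X', from the sampling
error of the plug-in formula at reference parameters. -/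
lemma gFormula_sub {n : ℕ} (D : Dataset K d n) (s : Finset (Fin n))
    (θ θ' : Fin 2 → Fin (d + 1) → ℝ) (τ : ℝ) :
    gFormula D s θ - τ =
      ∑ a, ((s.card : ℝ)⁻¹ * ∑ i ∈ s, aug (D i).x a) *
        ((θ 1 a - θ' 1 a) + (-1) * (θ 0 a - θ' 0 a)) + (gFormula D s θ' - τ) := by
  have h : ∀ ϑ : Fin 2 → Fin (d + 1) → ℝ, gFormula D s ϑ =
      ∑ a, ((s.card : ℝ)⁻¹ * ∑ i ∈ s, aug (D i).x a) * (ϑ 1 a - ϑ 0 a) := by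
    intro ϑ
    simp only [gFormula, dotProduct, ← Finset.sum_sub_distrib, mul_assoc, ← Finset.mul_sum,
      Finset.sum_mul]
    rw [Finset.sum_comm]
    congr 1
    exact Finset.sum_congr rfl fun _ _ => Finset.sum_congr rfl fun _ _ => by ring
  rw [h θ, h θ', ← add_sub_assoc, ← Finset.sum_add_distrib]
  congr 1
  exact Finset.sum_congr rfl fun _ _ => by ring

lemma sqrt_mul_ratio {n N : ℝ} (hn : 0 < n) (hN : 0 < N) (A τ : ℝ) :
    √n * (N⁻¹ * A - τ) = (N / n)⁻¹ * ((√n)⁻¹ * (A - N * τ)) := by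
  have hs : √n = n * (√n)⁻¹ := by
    rw [eq_mul_inv_iff_mul_eq₀ (Real.sqrt_pos.2 hn).ne', Real.mul_self_sqrt hn.le]
  calc _ = (n * (√n)⁻¹) * (N⁻¹ * A - τ) := by rw [← hs]
    _ = _ := by
      field_simp

/-- The plug-in estimator over a set `C'` of studies and arms is asymptotically linear as soon as
its outcome parameters behave like least squares estimators. -/
lemma Homogeneous.hasInfluence_gFormula (hS : Homogeneous S P c β σ)
    {C : Fin 2 → Finset (Fin K × Fin 2)} (hC : ∀ w, ∀ q ∈ C w, q.2 = w)
    {C' : Finset (Fin K × Fin 2)} (hC' : C'.Nonempty)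
    {θ : (n : ℕ) → Ω → Fin 2 → Fin (d + 1) → ℝ}
    (hθ : ∀ w a, HasInfluence P S.record (fun n ω => √(n : ℝ) *
      (θ n ω w a - thetaTrue c β w a)) (olsInfluence S P c β (C w) w a)) :
    HasInfluence P S.record (fun n ω => √(n : ℝ) *
        (gFormula (S.data n ω) (sel (S.data n ω) C') (θ n ω) - S.ate P))
      (effectInfluence S P c β
        (fun q => if q ∈ C q.2 then armSign q.2 * (S.pSel P (C q.2))⁻¹ else 0)
        (fun q => if q ∈ C' then (S.pSel P C')⁻¹ else 0)) := by
  have hp := hS.pSel_pos hC'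
  -- By homogeneity the mean of X' over any set of cells has the same limit E X', so the contraction
  -- with M⁻¹ also works for averages over a single study.
  have hmean : ∀ a, ∀ᵐ ω ∂P, Tendsto (fun n : ℕ => ((sel (S.data n ω) C').card : ℝ)⁻¹ *
      ∑ i ∈ sel (S.data n ω) C', aug (S.data n ω i).x a) atTop (𝓝 (S.meanAug P a)) := by
    intro a
    filter_upwards [hS.tendsto_card_sel C',
      hS.tendsto_sum_sel C' (measurable_aug a) (hS.integrable_aug a)] with ω h1 h2
    have h := h2.div h1 hp.ne'
    rw [mul_div_cancel_left₀ _ hp.ne'] at h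
    refine h.congr' ?_
    filter_upwards [eventually_gt_atTop 0] with n hn
    have : (n : ℝ) ≠ 0 := by exact_mod_cast hn.ne'
    rw [Pi.div_apply, div_div_div_cancel_right₀ this, div_eq_inv_mul]
  have hmeas : ∀ a n, Measurable fun ω => ((sel (S.data n ω) C').card : ℝ)⁻¹ *
      ∑ i ∈ sel (S.data n ω) C', aug (S.data n ω i).x a := fun a n =>
    (hS.measurable_card_sel C' n).inv.mul (hS.measurable_sum_sel_x C' (measurable_aug a) n)
  have h1 := hS.isIID.hasInfluence_sum Finset.univ fun a _ =>
    ((hθ 1 a).add ((hθ 0 a).const_mul hS.isIID (-1))).mul hS.isIID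
      (fun n => (hmeas a n).aemeasurable) (hmean a)
  have hratio : ∀ᵐ ω ∂P, Tendsto (fun n : ℕ => ((sel (S.data n ω) C').card / (n : ℝ))⁻¹) atTop
      (𝓝 (S.pSel P C')⁻¹) := by
    filter_upwards [hS.tendsto_card_sel C'] with ω h
    exact h.inv₀ hp.ne'
  have h2 := (hS.hasInfluence_effect C').mul hS.isIID
    (fun n => ((hS.measurable_card_sel C' n).div_const (n : ℝ)).inv.aemeasurable) hratio
  have hg : ∀ n, Measurable fun ω =>
      gFormula (S.data n ω) (sel (S.data n ω) C') (thetaTrue c β) := by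
    intro n
    simp only [gFormula, aug_dotProduct_thetaTrue]
    exact (hS.measurable_card_sel C' n).inv.mul (hS.measurable_sum_sel_x C'
      (F := fun x => c 1 + x ⬝ᵥ β 1 - (c 0 + x ⬝ᵥ β 0))
      ((measurable_const.add (measurable_dotProduct_right _)).sub
        (measurable_const.add (measurable_dotProduct_right _))) n)
  have h3 : HasInfluence P S.record (fun n ω => √(n : ℝ) *
      (gFormula (S.data n ω) (sel (S.data n ω) C') (thetaTrue c β) - S.ate P))
      (fun r => (S.pSel P C')⁻¹ *
        onRecord (fun q z => if q ∈ C' then S.effect P β z.1 else 0) r) := by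
    refine h2.congr (fun n => (((hg n).sub_const _).const_mul _).aemeasurable) ?_
    filter_upwards [hS.eventually_card_sel_pos hp] with ω hω
    filter_upwards [hω, eventually_gt_atTop 0] with n hn hn0
    have hn' : (0 : ℝ) < n := by exact_mod_cast hn0
    have hsum := sum_sel (S := S) C' (fun _ z => S.effect P β z.1) n ω
    have hsum' : ∑ i ∈ sel (S.data n ω) C', (aug (S.data n ω i).x ⬝ᵥ thetaTrue c β 1 -
        aug (S.data n ω i).x ⬝ᵥ thetaTrue c β 0) - (sel (S.data n ω) C').card * S.ate P =
        ∑ i ∈ Finset.range n, onRecord (fun q z => if q ∈ C' then S.effect P β z.1 else 0)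
          (S.record i ω) := by
      rw [← hsum, ← nsmul_eq_mul, ← Finset.sum_const, ← Finset.sum_sub_distrib]
      refine Finset.sum_congr rfl fun i _ => ?_
      rw [hS.aug_dotProduct_sub_ate]
      rfl
    rw [rootSum, ← hsum', gFormula]
    exact sqrt_mul_ratio hn' hn _ _
  have h := h1.add h3
  have hT : ∀ (n : ℕ) ω, √(n : ℝ) *
      (gFormula (S.data n ω) (sel (S.data n ω) C') (θ n ω) - S.ate P) =
      ∑ a, ((sel (S.data n ω) C').card : ℝ)⁻¹ *
        (∑ i ∈ sel (S.data n ω) C', aug (S.data n ω i).x a) *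
        (√(n : ℝ) * (θ n ω 1 a - thetaTrue c β 1 a) +
          -1 * (√(n : ℝ) * (θ n ω 0 a - thetaTrue c β 0 a))) +
      √(n : ℝ) * (gFormula (S.data n ω) (sel (S.data n ω) C') (thetaTrue c β) - S.ate P) := by
    intro n ω
    rw [gFormula_sub _ _ (θ n ω) (thetaTrue c β), mul_add, Finset.mul_sum]
    congr 1
    exact Finset.sum_congr rfl fun _ _ => by ring
  simp only [hT]
  convert h using 1
  funext r
  simp only [mul_add, Finset.sum_add_distrib, mul_left_comm _ (-1 : ℝ), ← Finset.mul_sum,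
    hS.sum_meanAug_olsInfluence]
  obtain ⟨x, w, k, y⟩ := r
  have hx : aug x 0 = 1 := rfl
  -- An individual contributes to the regression of its own arm only, so the difference of the two
  -- scores is the signed noise of the arm received.
  have h01 : ((k, 0) : Fin K × Fin 2) ∉ C 1 := fun hmem => by simpa using hC 1 _ hmem
  have h10 : ((k, 1) : Fin K × Fin 2) ∉ C 0 := fun hmem => by simpa using hC 0 _ hmem
  simp only [effectInfluence, score, onRecord, hx, mul_one]
  fin_cases w
  · simp only [Fin.zero_eta, h01, if_false, armSign]
    split_ifs <;> simp
  · simp only [Fin.mk_one, h10, if_false, armSign]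
    split_ifs <;> simp

lemma Homogeneous.isAsymptoticVariance_of_hasInfluence (hS : Homogeneous S P c β σ)
    {N : ℕ → Ω → ℕ} {T : ℕ → Ω → ℝ} {τ V : ℝ} {α γ : Fin K × Fin 2 → ℝ}
    (h : HasInfluence P S.record (fun n ω => √(N n ω : ℝ) * (T n ω - τ))
      (effectInfluence S P c β α γ))
    (hV : ∑ q, S.pCell P q * (α q ^ 2 * σ ^ 2 + γ q ^ 2 * S.effectSq P β) = V) :
    IsAsymptoticVariance P N T τ V := by
  rw [← hV, ← hS.integral_effectInfluence_sq α γ]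
  exact ⟨integral_nonneg fun _ => sq_nonneg _, h.tendstoInDistribution hS.isIID⟩

lemma Homogeneous.effectSq_nonneg (hS : Homogeneous S P c β σ) : 0 ≤ S.effectSq P β := by
  rw [← hS.integral_effect_sq]
  exact integral_nonneg fun _ => sq_nonneg _

lemma Homogeneous.pTreat_mem (hS : Homogeneous S P c β σ) : 0 < S.pTreat P ∧ S.pTreat P < 1 := by
  have h1 := hS.pSel_pos (hS.armCells_nonempty 1)
  have h0 := hS.pSel_pos (hS.armCells_nonempty 0)
  rw [hS.pSel_armCells_one] at h1
  rw [hS.pSel_armCells_zero] at h0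
  exact ⟨h1, by linarith⟩

/-- Plug-in estimators over all the data whose outcome parameters are asymptotically equivalent
to the pooled least squares estimators have the asymptotic variance of the pooled estimator. -/
lemma Homogeneous.isAsymptoticVariance_gFormula_univ (hS : Homogeneous S P c β σ)
    {θ : (n : ℕ) → Ω → Fin 2 → Fin (d + 1) → ℝ}
    (hθ : ∀ w a, HasInfluence P S.record (fun n ω => √(n : ℝ) *
      (θ n ω w a - thetaTrue c β w a)) (olsInfluence S P c β (armCells K w) w a)) :
    IsAsymptoticVariance P (fun n _ => n)
      (fun n ω => gFormula (S.data n ω) Finset.univ (θ n ω)) (S.ate P) (S.avarPool P β σ) := by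
  have h := hS.hasInfluence_gFormula (C := armCells K) (fun w q hq => (Finset.mem_filter.1 hq).2)
    (C' := Finset.univ) (hS.armCells_nonempty 0 |>.mono (Finset.subset_univ _)) hθ
  simp only [← univ_eq_sel] at h
  refine hS.isAsymptoticVariance_of_hasInfluence h ?_
  have hmem : ∀ q : Fin K × Fin 2, q ∈ armCells K q.2 := fun q => by simp [armCells]
  simp only [hmem, if_true, Finset.mem_univ, mul_pow, armSign_sq, hS.pSel_univ, inv_one, one_pow,
    one_mul, mul_add, Finset.sum_add_distrib, ← Finset.sum_mul]
  have hu : ∑ q, S.pCell P q = 1 := hS.pSel_univ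
  -- Grouped by arm, the noise contributes σ² / P(W = w) for each w, and 1/p + 1/(1 - p) = 1/(p(1 -
  -- p)).
  have hs : ∑ q : Fin K × Fin 2, S.pCell P q * ((S.pSel P (armCells K q.2))⁻¹ ^ 2 * σ ^ 2) =
      ∑ w, S.pSel P (armCells K w) * ((S.pSel P (armCells K w))⁻¹ ^ 2 * σ ^ 2) := by
    rw [Fintype.sum_prod_type_right]
    refine Finset.sum_congr rfl fun w _ => ?_
    change ∑ k, S.pCell P (k, w) * ((S.pSel P (armCells K w))⁻¹ ^ 2 * σ ^ 2) = _
    rw [← Finset.sum_mul, ← sum_armCells w]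
    rfl
  have hp := hS.pTreat_mem
  have hp0 : 1 - S.pTreat P ≠ 0 := by linarith [hp.2]
  have hp1 := hp.1.ne'
  rw [hs, hu, one_mul, Fin.sum_univ_two, hS.pSel_armCells_one, hS.pSel_armCells_zero,
    Population.avarPool]
  congr 1
  field_simp
  ring

/-- The scale is √n rather than √n_k, so that all studies are expressed over the same sequence of
records. Both coefficients vanish outside study k. -/
lemma Homogeneous.hasInfluence_tauLocal (hS : Homogeneous S P c β σ) (k : Fin K) :
    HasInfluence P S.record (fun n ω => √(n : ℝ) * (tauLocal k (S.data n ω) - S.ate P))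
      (effectInfluence S P c β (fun q => if q.1 = k then armSign q.2 * (S.pCell P q)⁻¹ else 0)
        (fun q => if q.1 = k then (S.rho P k)⁻¹ else 0)) := by
  have h := hS.hasInfluence_gFormula (C := fun w => {(k, w)}) (by simp) (siteCells_nonempty k)
    (θ := fun n ω => thetaLocal (S.data n ω) k) (hS.hasInfluence_thetaLocal k)
  simp only [← site_eq_sel, hS.pSel_siteCells] at h
  have hα : (fun q : Fin K × Fin 2 => if q.1 = k then armSign q.2 * (S.pCell P q)⁻¹ else 0) =
      fun q => if q ∈ ({(k, q.2)} : Finset (Fin K × Fin 2)) then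
        armSign q.2 * (S.pSel P {(k, q.2)})⁻¹ else 0 := by
    funext ⟨j, w⟩
    by_cases hj : j = k
    · simp [hj, Population.pSel]
    · simp [hj]
  have hγ : (fun q : Fin K × Fin 2 => if q.1 = k then (S.rho P k)⁻¹ else 0) =
      fun q => if q ∈ siteCells k then (S.rho P k)⁻¹ else 0 := by
    funext q
    simp [siteCells]
  rw [hα, hγ]
  exact h

lemma const_mul_effectInfluence (b : ℝ) (α γ : Fin K × Fin 2 → ℝ) :
    (fun r => b * effectInfluence S P c β α γ r) =
      effectInfluence S P c β (fun q => b * α q) (fun q => b * γ q) := by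
  funext r
  simp only [effectInfluence, onRecord]
  ring

lemma sum_effectInfluence {ι : Type*} (s : Finset ι) (α γ : ι → Fin K × Fin 2 → ℝ) :
    (fun r => ∑ j ∈ s, effectInfluence S P c β (α j) (γ j) r) =
      effectInfluence S P c β (fun q => ∑ j ∈ s, α j q) (fun q => ∑ j ∈ s, γ j q) := by
  funext r
  simp only [effectInfluence, onRecord, Finset.sum_add_distrib, Finset.sum_mul]

lemma Homogeneous.inv_pCell_add (hS : Homogeneous S P c β σ) (k : Fin K) :
    σ ^ 2 * ((S.pCell P (k, 0))⁻¹ + (S.pCell P (k, 1))⁻¹) + (S.rho P k)⁻¹ * S.effectSq P β =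
      (S.rho P k)⁻¹ * S.avarLocal P β σ k := by
  have h := hS.pStudy_mem k
  have hr := (hS.rho_pos k).ne'
  have h0 : 1 - S.pStudy P k ≠ 0 := by linarith [h.2]
  have h1 := h.1.ne'
  rw [hS.pCell_zero, hS.pCell_one, Population.avarLocal]
  field_simp
  ring

/-- The influence functions of different studies have disjoint supports, so there are no covariances
and the variances v_k / ρ_k add with squared weights. -/
lemma Homogeneous.sum_local_variance (hS : Homogeneous S P c β σ) (b : Fin K → ℝ) :
    ∑ q : Fin K × Fin 2, S.pCell P q * ((b q.1 * (armSign q.2 * (S.pCell P q)⁻¹)) ^ 2 * σ ^ 2 +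
      (b q.1 * (S.rho P q.1)⁻¹) ^ 2 * S.effectSq P β) =
      ∑ k, b k ^ 2 * ((S.rho P k)⁻¹ * S.avarLocal P β σ k) := by
  rw [Fintype.sum_prod_type]
  refine Finset.sum_congr rfl fun k _ => ?_
  have hr := (hS.rho_pos k).ne'
  have hsum : S.pCell P (k, 0) + S.pCell P (k, 1) = S.rho P k := by
    rw [← hS.pSel_siteCells, Population.pSel, sum_siteCells]
  rw [← hS.inv_pCell_add, Fin.sum_univ_two]
  simp only [mul_pow, armSign_sq, one_mul]
  have e : ∀ w, S.pCell P (k, w) * (S.pCell P (k, w))⁻¹ ^ 2 = (S.pCell P (k, w))⁻¹ := by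
    intro w
    have := (hS.pCell_pos (k, w)).ne'
    field_simp
  have er : S.rho P k * (S.rho P k)⁻¹ ^ 2 = (S.rho P k)⁻¹ := by field_simp
  linear_combination b k ^ 2 * σ ^ 2 * e 0 + b k ^ 2 * σ ^ 2 * e 1 +
    b k ^ 2 * S.effectSq P β * er + b k ^ 2 * (S.rho P k)⁻¹ ^ 2 * S.effectSq P β * hsum

lemma Homogeneous.tendsto_card_site (hS : Homogeneous S P c β σ) (k : Fin K) :
    ∀ᵐ ω ∂P, Tendsto (fun n : ℕ => ((site (S.data n ω) k).card : ℝ) / n) atTop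
      (𝓝 (S.rho P k)) := by
  simp only [site_eq_sel, ← hS.pSel_siteCells]
  exact hS.tendsto_card_sel _

lemma Homogeneous.measurable_card_site (hS : Homogeneous S P c β σ) (k : Fin K) (n : ℕ) :
    Measurable fun ω => ((site (S.data n ω) k).card : ℝ) := by
  simp only [site_eq_sel]
  exact hS.measurable_card_sel _ n

lemma Homogeneous.measurable_tauLocal (hS : Homogeneous S P c β σ) (k : Fin K) (n : ℕ) :
    Measurable fun ω => tauLocal k (S.data n ω) := by
  have h : ∀ ω, tauLocal k (S.data n ω) = ∑ a, ((sel (S.data n ω) (siteCells k)).card : ℝ)⁻¹ *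
      (∑ i ∈ sel (S.data n ω) (siteCells k), aug (S.data n ω i).x a) *
        (thetaLocal (S.data n ω) k 1 a + -1 * thetaLocal (S.data n ω) k 0 a) := by
    intro ω
    have := gFormula_sub (S.data n ω) (sel (S.data n ω) (siteCells k))
      (thetaLocal (S.data n ω) k) 0 0
    simpa [gFormula, tauLocal, site_eq_sel] using this
  simp only [h]
  exact Finset.measurable_sum _ fun a _ => ((hS.measurable_card_sel _ n).inv.mul
    (hS.measurable_sum_sel_x _ (measurable_aug a) n)).mul
    ((hS.measurable_thetaLocal k 1 a n).add ((hS.measurable_thetaLocal k 0 a n).const_mul _))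

/-- The local estimators, at the scale of the study sample sizes. -/
lemma Homogeneous.isAsymptoticVariance_tauLocal (hS : Homogeneous S P c β σ) (k : Fin K) :
    IsAsymptoticVariance P (fun n ω => (site (S.data n ω) k).card)
      (fun n ω => tauLocal k (S.data n ω)) (S.ate P) (S.avarLocal P β σ k) := by
  -- The random scale √n_k is √n times √(n_k / n), a factor converging almost surely to √ρ_k.
  have hlim : ∀ᵐ ω ∂P, Tendsto (fun n : ℕ => √(((site (S.data n ω) k).card : ℝ) / n)) atTop
      (𝓝 √(S.rho P k)) := by
    filter_upwards [hS.tendsto_card_site k] with ω h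
    exact h.sqrt
  have h := (hS.hasInfluence_tauLocal k).mul hS.isIID
    (fun n => (((hS.measurable_card_site k n).div_const (n : ℝ)).sqrt).aemeasurable) hlim
  rw [const_mul_effectInfluence] at h
  have h' := h.congr (T' := fun n ω => √((site (S.data n ω) k).card : ℝ) *
    (tauLocal k (S.data n ω) - S.ate P)) (fun n => ((hS.measurable_card_site k n).sqrt.mul
      ((hS.measurable_tauLocal k n).sub_const _)).aemeasurable) (ae_of_all _ fun ω => by
        filter_upwards [eventually_gt_atTop 0] with n hn
        have hn' : (0 : ℝ) < n := by exact_mod_cast hn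
        rw [← mul_assoc, ← Real.sqrt_mul (by positivity), div_mul_cancel₀ _ hn'.ne'])
  refine hS.isAsymptoticVariance_of_hasInfluence h' ?_
  -- With weight √ρ_k on study k alone, the squared weight cancels the factor 1 / ρ_k.
  have hv := hS.sum_local_variance (fun j => if j = k then √(S.rho P k) else 0)
  have hr := hS.rho_pos k
  simp only [ite_pow, Real.sq_sqrt hr.le, zero_pow two_ne_zero, ite_mul, zero_mul,
    Finset.sum_ite_eq', Finset.mem_univ, if_true] at hv
  rw [mul_inv_cancel_left₀ hr.ne'] at hv
  rw [← hv]
  refine Finset.sum_congr rfl fun q _ => ?_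
  by_cases hq : q.1 = k
  · simp [hq]
  · simp [hq]

/-- Weighted averages of the local estimators. -/
lemma Homogeneous.isAsymptoticVariance_weighted (hS : Homogeneous S P c β σ)
    {B : Fin K → ℕ → Ω → ℝ} {b : Fin K → ℝ} {T : ℕ → Ω → ℝ} {V : ℝ}
    (hB : ∀ k n, Measurable (B k n))
    (hBb : ∀ k, ∀ᵐ ω ∂P, Tendsto (fun n => B k n ω) atTop (𝓝 (b k)))
    (hsum : ∀ᵐ ω ∂P, ∀ᶠ n in atTop, ∑ k, B k n ω = 1)
    (hT : ∀ n ω, T n ω = ∑ k, B k n ω * tauLocal k (S.data n ω))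
    (hV : ∑ k, b k ^ 2 * ((S.rho P k)⁻¹ * S.avarLocal P β σ k) = V) :
    IsAsymptoticVariance P (fun n _ => n) T (S.ate P) V := by
  have h := hS.isIID.hasInfluence_sum Finset.univ fun k _ => (hS.hasInfluence_tauLocal k).mul
    hS.isIID (fun n => (hB k n).aemeasurable) (hBb k)
  simp only [congrFun (const_mul_effectInfluence _ _ _) _] at h
  rw [sum_effectInfluence] at h
  have h' := h.congr (T' := fun n ω => √(n : ℝ) * (T n ω - S.ate P)) (fun n => by
      simp only [hT]
      exact (((Finset.measurable_sum _ fun k _ => (hB k n).mul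
        (hS.measurable_tauLocal k n)).sub_const _).const_mul _).aemeasurable) (by
      filter_upwards [hsum] with ω hω
      filter_upwards [hω] with n hn
      rw [hT]
      -- Since the random weights sum to one, τ can be subtracted inside the sum and only the limits
      -- of the weights matter.
      calc _ = √(n : ℝ) * (∑ k, B k n ω * tauLocal k (S.data n ω) -
            (∑ k, B k n ω) * S.ate P) := by rw [hn, one_mul]
        _ = _ := by
          rw [Finset.sum_mul, ← Finset.sum_sub_distrib, Finset.mul_sum]
          exact Finset.sum_congr rfl fun k _ => by ring)
  refine hS.isAsymptoticVariance_of_hasInfluence h' ?_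
  rw [← hV, ← hS.sum_local_variance]
  simp

end Effects

/-! ### Convergence of federated averaging with one local step -/

section FedAvg

/-- In an orthonormal eigenbasis the iteration multiplies each coordinate by 1 - η λ, and 0 < η λ <
2 gives absolute value less than one. -/
lemma tendsto_pow_mulVec {m : Type*} [Fintype m] [DecidableEq m] {A : Matrix m m ℝ}
    (hA : A.PosDef) {η : ℝ} (hη : 0 < η)
    (hL : ∀ L : ℝ, Module.End.HasEigenvalue (Matrix.toLin' A) L → η * L < 2) (v : m → ℝ) :
    Tendsto (fun T : ℕ => ((1 - η • A) ^ T).mulVec v) atTop (𝓝 0) := by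
  set u : m → m → ℝ := fun i => ⇑(hA.1.eigenvectorBasis i) with hu
  set l := hA.1.eigenvalues
  have hAu : ∀ i, A.mulVec (u i) = l i • u i := hA.1.mulVec_eigenvectorBasis
  have hu0 : ∀ i, u i ≠ 0 := by
    intro i h
    have h1 := hA.1.eigenvectorBasis.toBasis.ne_zero i
    apply h1
    ext j
    simpa using congrFun h j
  have heig : ∀ i, Module.End.HasEigenvalue (Matrix.toLin' A) (l i) := fun i =>
    Module.End.hasEigenvalue_of_hasEigenvector
      (Module.End.hasEigenvector_iff.2 ⟨Module.End.mem_eigenspace_iff.2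
        (by rw [Matrix.toLin'_apply, hAu]), hu0 i⟩)
  have hpow : ∀ i (T : ℕ), ((1 - η • A) ^ T).mulVec (u i) = (1 - η * l i) ^ T • u i := by
    intro i T
    induction T with
    | zero => simp
    | succ T ih =>
      rw [pow_succ, ← Matrix.mulVec_mulVec, Matrix.sub_mulVec, Matrix.one_mulVec,
        Matrix.smul_mulVec, hAu, smul_smul,
        show u i - (η * l i) • u i = (1 - η * l i) • u i by rw [sub_smul, one_smul],
        Matrix.mulVec_smul, ih, smul_smul,
        pow_succ']
  have hv : v = ∑ i, (hA.1.eigenvectorBasis.repr (WithLp.toLp 2 v) i) • u i := by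
    have h := hA.1.eigenvectorBasis.sum_repr (WithLp.toLp 2 v)
    funext j
    have := congrArg (fun x : EuclideanSpace ℝ m => x j) h
    simpa [hu, Finset.sum_apply] using this.symm
  have hlim : ∀ i, Tendsto (fun T : ℕ => (1 - η * l i) ^ T) atTop (𝓝 0) := by
    intro i
    apply tendsto_pow_atTop_nhds_zero_of_abs_lt_one
    have h1 := hL _ (heig i)
    have h2 := mul_pos hη (hA.eigenvalues_pos i)
    rw [abs_lt]
    constructor <;> linarith
  rw [hv]
  simp only [Matrix.mulVec_sum, Matrix.mulVec_smul, hpow]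
  have : Tendsto (fun T : ℕ => ∑ i, (hA.1.eigenvectorBasis.repr (WithLp.toLp 2 v) i) •
      (1 - η * l i) ^ T • u i) atTop
      (𝓝 (∑ i, (hA.1.eigenvectorBasis.repr (WithLp.toLp 2 v) i) • (0 : ℝ) • u i)) :=
    tendsto_finsetSum _ fun i _ => ((hlim i).smul_const _).const_smul _
  simpa using this

variable {K d n : ℕ}

lemma posSemidef_gram (D : Dataset K d n) (s : Finset (Fin n)) : (gram D s).PosSemidef := by
  refine Matrix.posSemidef_sum s fun i _ => ?_
  simpa using Matrix.posSemidef_vecMulVec_self_star (aug (D i).x)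

/-- A round of FedAvg with one local step and a common learning rate is a gradient step on the
pooled mean squared error. -/
lemma fedAvg_round {p : FedAvgParams K d} {η : ℝ} (hsteps : p.steps = 1)
    (hrate : ∀ k, p.rate k = η) (D : Dataset K d n) (w : Fin 2)
    (hw : ((arm D w).card : ℝ) ≠ 0) (θ : Fin (d + 1) → ℝ) :
    ∑ k, (((cell D k w).card : ℝ) / (arm D w).card) • localUpdate p D w k θ =
      θ + (η * (2 / ((arm D w).card : ℝ))) •
        (crossMoment D (arm D w) - (gram D (arm D w)).mulVec θ) := by
  have hcell : ∀ k, (((cell D k w).card : ℝ) / (arm D w).card) • localUpdate p D w k θ =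
      (((cell D k w).card : ℝ) / (arm D w).card) • θ + (η * (2 / ((arm D w).card : ℝ))) •
        (crossMoment D (cell D k w) - (gram D (cell D k w)).mulVec θ) := by
    intro k
    have hg : ∑ i ∈ cell D k w, ((D i).y - aug (D i).x ⬝ᵥ θ) • aug (D i).x =
        crossMoment D (cell D k w) - (gram D (cell D k w)).mulVec θ := by
      rw [crossMoment, gram, Matrix.sum_mulVec, ← Finset.sum_sub_distrib]
      refine Finset.sum_congr rfl fun i _ => ?_
      rw [sub_smul, Matrix.vecMulVec_mulVec]
      simp
    rw [localUpdate, hsteps, Function.iterate_one, hrate, mseGrad, hg, smul_sub, smul_smul,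
      smul_smul, sub_eq_add_neg, ← neg_smul]
    -- An empty cell has zero weight and empty sums. Otherwise the count in the weight cancels the
    -- one in the local mean, which leaves the factor 2 / n⁽ʷ⁾ common to all studies.
    rcases eq_or_ne ((cell D k w).card : ℝ) 0 with h | h
    · have : cell D k w = ∅ := by simpa using h
      simp [this, crossMoment, gram]
    · congr 2
      field_simp
  simp only [hcell]
  rw [Finset.sum_add_distrib, ← Finset.sum_smul, ← Finset.sum_div, ← card_arm_eq_sum,
    div_self hw, one_smul, ← Finset.smul_sum, Finset.sum_sub_distrib, ← crossMoment_arm,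
    gram_arm, Matrix.sum_mulVec]

/-- One local step per round and a learning rate smaller than `2 / L` make FedAvg converge to the
pooled least squares estimator. -/
theorem FedAvgRule.OneStep.tuned {r : FedAvgRule K d} (hr : r.OneStep) : r.Tuned := by
  intro n D w hfull
  obtain ⟨hsteps, η, hη, hrate, hL⟩ := hr n D w hfull
  have hdet := (fullRank_iff D _).1 hfull
  -- Full rank excludes an empty arm: its Gram matrix would be zero, of size d + 1 ≥ 1.
  have hw : ((arm D w).card : ℝ) ≠ 0 := by
    intro h
    have : arm D w = ∅ := by simpa using h
    simp [this, gram] at hdet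
  have hpos : (0 : ℝ) < 2 / (arm D w).card := by positivity
  set A := (2 / ((arm D w).card : ℝ)) • gram D (arm D w) with hAdef
  have hA : A.PosDef :=
    ((posSemidef_gram D _).posDef_iff_det_ne_zero.2 hdet).smul hpos
  have hcross : crossMoment D (arm D w) = (gram D (arm D w)).mulVec (thetaPool D w) := by
    rw [thetaPool, ols, Matrix.mulVec_mulVec, Matrix.mul_nonsing_inv _ hdet.isUnit,
      Matrix.one_mulVec]
  -- Pooled least squares is a fixed point of the round by the normal equations, so the error is
  -- multiplied by 1 - η A each time.
  have hiter : ∀ T : ℕ, fedAvg (r n D w) D w T = thetaPool D w +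
      ((1 - η • A) ^ T).mulVec ((r n D w).init - thetaPool D w) := by
    intro T
    induction T with
    | zero => simp [fedAvg]
    | succ T ih =>
      rw [fedAvg] at ih ⊢
      rw [Function.iterate_succ_apply', ih, fedAvg_round hsteps hrate D w hw, hcross,
        ← Matrix.mulVec_sub, pow_succ', ← Matrix.mulVec_mulVec, Matrix.sub_mulVec,
        Matrix.one_mulVec, hAdef, smul_smul, Matrix.smul_mulVec, sub_add_cancel_left,
        Matrix.mulVec_neg, smul_neg]
      abel
  have h := (tendsto_pow_mulVec hA hη hL ((r n D w).init - thetaPool D w)).const_add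
    (thetaPool D w)
  rw [add_zero] at h
  exact h.congr fun T => (hiter T).symm

end FedAvg

/-! ### Inequalities between the asymptotic variances -/

section Comparison

variable {ι : Type*} [Fintype ι] {ρ : ι → ℝ}

lemma weighted_sq_dev_pos (hρ : ∀ k, 0 < ρ k) {f g : ι → ℝ} (hg : ∀ k, 0 < g k)
    (hf : ∃ j k, f j ≠ f k) (m : ℝ) : 0 < ∑ k, ρ k * ((f k - m) ^ 2 * g k) := by
  obtain ⟨i, hi⟩ : ∃ i, f i ≠ m := by
    by_contra! h
    obtain ⟨j, k, hjk⟩ := hf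
    exact hjk ((h j).trans (h k).symm)
  refine Finset.sum_pos' (fun k _ => mul_nonneg (hρ k).le (mul_nonneg (sq_nonneg _) (hg k).le))
    ⟨i, Finset.mem_univ i, ?_⟩
  exact mul_pos (hρ i) (mul_pos (by have := sub_ne_zero.2 hi; positivity) (hg i))

lemma weighted_sq_dev_nonneg (hρ : ∀ k, 0 < ρ k) (f : ι → ℝ) {g : ι → ℝ} (hg : ∀ k, 0 < g k)
    (m : ℝ) : 0 ≤ ∑ k, ρ k * ((f k - m) ^ 2 * g k) :=
  Finset.sum_nonneg fun k _ => mul_nonneg (hρ k).le (mul_nonneg (sq_nonneg _) (hg k).le)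

/-- The defect in the inequality between weighted harmonic and arithmetic means. -/
lemma sum_div_sub_inv_sum (hsum : ∑ k, ρ k = 1) {v : ι → ℝ} (hv : ∀ k, 0 < v k)
    (hB : 0 < ∑ k, ρ k * v k) :
    ∑ k, ρ k / v k - (∑ k, ρ k * v k)⁻¹ =
      ∑ k, ρ k * ((v k - ∑ j, ρ j * v j) ^ 2 * (v k * (∑ j, ρ j * v j) ^ 2)⁻¹) := by
  set B := ∑ j, ρ j * v j with hBdef
  have h : ∀ k, ρ k * ((v k - B) ^ 2 * (v k * B ^ 2)⁻¹) =
      ρ k / v k - 2 * B⁻¹ * ρ k + (B ^ 2)⁻¹ * (ρ k * v k) := by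
    intro k
    have := (hv k).ne'
    field_simp
    ring
  simp only [h, Finset.sum_add_distrib, Finset.sum_sub_distrib, ← Finset.mul_sum, hsum, ← hBdef]
  field_simp
  ring

/-- The exact defect is a positively weighted sum of squared deviations of v from its mean, which
yields the inequality and its strict form together. -/
lemma inv_sum_div_le (hρ : ∀ k, 0 < ρ k) (hsum : ∑ k, ρ k = 1) {v : ι → ℝ} (hv : ∀ k, 0 < v k) :
    (∑ k, ρ k / v k)⁻¹ ≤ ∑ k, ρ k * v k ∧
      ((∃ j k, v j ≠ v k) → (∑ k, ρ k / v k)⁻¹ < ∑ k, ρ k * v k) := by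
  have hne : (Finset.univ : Finset ι).Nonempty := by
    by_contra h
    simp [Finset.not_nonempty_iff_eq_empty.1 h] at hsum
  have hB : 0 < ∑ k, ρ k * v k := Finset.sum_pos (fun k _ => mul_pos (hρ k) (hv k)) hne
  have hg : ∀ k, 0 < (v k * (∑ j, ρ j * v j) ^ 2)⁻¹ := fun k => by
    have := hv k
    positivity
  have hid := sum_div_sub_inv_sum hsum hv hB
  constructor
  · have := weighted_sq_dev_nonneg hρ v hg (∑ j, ρ j * v j)
    exact inv_le_of_inv_le₀ hB (by linarith)
  · intro hex
    have := weighted_sq_dev_pos hρ hg hex (∑ j, ρ j * v j)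
    exact inv_lt_of_inv_lt₀ hB (by linarith)

/-- Tangent line inequality for the concave function `u ↦ u / (s + e u)`. -/
lemma div_add_le_tangent {s e u t : ℝ} (hs : 0 < s) (he : 0 ≤ e) (hu : 0 < u) (ht : 0 < t) :
    (s / u + e)⁻¹ ≤ (s / t + e)⁻¹ + s / (s + e * t) ^ 2 * (u - t) := by
  have h1 : 0 < s + e * u := by positivity
  have h2 : 0 < s + e * t := by positivity
  have e1 : (s / u + e)⁻¹ = u / (s + e * u) := by field_simp
  have e2 : (s / t + e)⁻¹ = t / (s + e * t) := by field_simp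
  rw [e1, e2, ← sub_nonneg]
  have : t / (s + e * t) + s / (s + e * t) ^ 2 * (u - t) - u / (s + e * u) =
      s * e * (u - t) ^ 2 / ((s + e * t) ^ 2 * (s + e * u)) := by
    field_simp
    ring
  rw [this]
  positivity

/-- Averaging the tangent inequality at t = q(1 - q) bounds the mean precision by the pooled
precision minus m times the variance of the p_k. Strictness comes from that variance and not from
concavity, so it persists when e = 0. -/
lemma pooled_le_inv_sum_div (hρ : ∀ k, 0 < ρ k) (hsum : ∑ k, ρ k = 1) {p : ι → ℝ}
    (hp : ∀ k, 0 < p k ∧ p k < 1) {s e q : ℝ} (hs : 0 < s) (he : 0 ≤ e)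
    (hq : q = ∑ k, ρ k * p k) (hq01 : 0 < q ∧ q < 1) :
    s / (q * (1 - q)) + e ≤ (∑ k, ρ k / (s / (p k * (1 - p k)) + e))⁻¹ ∧
      ((∃ j k, p j ≠ p k) →
        s / (q * (1 - q)) + e < (∑ k, ρ k / (s / (p k * (1 - p k)) + e))⁻¹) := by
  have hne : (Finset.univ : Finset ι).Nonempty := by
    by_contra h
    simp [Finset.not_nonempty_iff_eq_empty.1 h] at hsum
  have hu : ∀ k, 0 < p k * (1 - p k) := fun k => mul_pos (hp k).1 (by linarith [(hp k).2])
  have ht : 0 < q * (1 - q) := mul_pos hq01.1 (by linarith [hq01.2])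
  have hV : 0 < s / (q * (1 - q)) + e := by positivity
  have hv : ∀ k, 0 < s / (p k * (1 - p k)) + e := fun k => by
    have := hu k
    positivity
  have hpos : 0 < ∑ k, ρ k / (s / (p k * (1 - p k)) + e) :=
    Finset.sum_pos (fun k _ => div_pos (hρ k) (hv k)) hne
  -- The slope of u ↦ u / (s + e u) at u = q(1 - q).
  set m := s / (s + e * (q * (1 - q))) ^ 2 with hm
  have hm0 : 0 < m := by positivity
  -- The law of total variance for the treatment indicator: the variance within studies is the total
  -- variance minus the variance between studies.
  have hdev : ∑ k, ρ k * (p k * (1 - p k)) - q * (1 - q) =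
      -∑ k, ρ k * ((p k - q) ^ 2 * 1) := by
    have h : ∀ k, ρ k * ((p k - q) ^ 2 * 1) =
        (1 - 2 * q) * (ρ k * p k) - ρ k * (p k * (1 - p k)) + q ^ 2 * ρ k := fun k => by ring
    simp only [h, Finset.sum_add_distrib, Finset.sum_sub_distrib, ← Finset.mul_sum, hsum, ← hq]
    ring
  have hle : ∑ k, ρ k / (s / (p k * (1 - p k)) + e) ≤
      (s / (q * (1 - q)) + e)⁻¹ + m * (∑ k, ρ k * (p k * (1 - p k)) - q * (1 - q)) := by
    calc _ ≤ ∑ k, ρ k * ((s / (q * (1 - q)) + e)⁻¹ + m * (p k * (1 - p k) - q * (1 - q))) := by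
          refine Finset.sum_le_sum fun k _ => ?_
          rw [div_eq_mul_inv]
          exact mul_le_mul_of_nonneg_left (div_add_le_tangent hs he (hu k) ht) (hρ k).le
      _ = _ := by
          have h : ∀ k, ρ k * ((s / (q * (1 - q)) + e)⁻¹ + m * (p k * (1 - p k) - q * (1 - q))) =
              ((s / (q * (1 - q)) + e)⁻¹ - m * (q * (1 - q))) * ρ k +
                m * (ρ k * (p k * (1 - p k))) := fun k => by ring
          simp only [h, Finset.sum_add_distrib, ← Finset.mul_sum, hsum]
          ring
  rw [hdev] at hle
  constructor
  · have h := mul_nonneg hm0.le (weighted_sq_dev_nonneg hρ p (g := fun _ => 1)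
      (fun _ => one_pos) q)
    exact le_inv_of_le_inv₀ hpos (by linarith)
  · intro hex
    have h := mul_pos hm0 (weighted_sq_dev_pos hρ (g := fun _ => 1) (fun _ => one_pos) hex q)
    exact lt_inv_of_lt_inv₀ hpos (by linarith)

end Comparison

/-! ### The two meta-analyses -/

section Estimators

variable {K d : ℕ} {Ω : Type*} [MeasurableSpace Ω] {P : Measure Ω} [IsProbabilityMeasure P]
  {S : Population K d Ω} {c : Fin 2 → ℝ} {β : Fin 2 → Fin d → ℝ} {σ : ℝ}

lemma Homogeneous.avarLocal_pos (hS : Homogeneous S P c β σ) (k : Fin K) :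
    0 < S.avarLocal P β σ k := by
  have h := hS.pStudy_mem k
  have hu : 0 < S.pStudy P k * (1 - S.pStudy P k) := mul_pos h.1 (by linarith [h.2])
  exact add_pos_of_pos_of_nonneg (div_pos (pow_pos hS.sigma_pos 2) hu) hS.effectSq_nonneg

lemma Homogeneous.avarMetaSW_eq (hS : Homogeneous S P c β σ) :
    S.avarMetaSW P β σ = ∑ k, S.rho P k * S.avarLocal P β σ k := by
  have h : ∀ k, S.rho P k * S.avarLocal P β σ k =
      σ ^ 2 * (S.rho P k / (S.pStudy P k * (1 - S.pStudy P k))) + S.rho P k * S.effectSq P β :=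
    fun k => by
      rw [Population.avarLocal]
      ring
  simp only [h, Finset.sum_add_distrib, ← Finset.mul_sum, ← Finset.sum_mul, hS.sum_rho, one_mul]
  rfl

/-- Meta-analysis with sample-size weights. -/
lemma Homogeneous.isAsymptoticVariance_tauMetaSW (hS : Homogeneous S P c β σ) :
    IsAsymptoticVariance P (fun n _ => n) (fun n ω => tauMetaSW (S.data n ω)) (S.ate P)
      (S.avarMetaSW P β σ) := by
  refine hS.isAsymptoticVariance_weighted
    (B := fun k n ω => ((site (S.data n ω) k).card : ℝ) / n) (b := S.rho P)
    (fun k n => (hS.measurable_card_site k n).div_const _) hS.tendsto_card_site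
    (ae_of_all _ fun ω => ?_) (fun n ω => rfl) ?_
  · filter_upwards [eventually_gt_atTop 0] with n hn
    have : (n : ℝ) ≠ 0 := by exact_mod_cast hn.ne'
    rw [← Finset.sum_div, sum_card_site, div_self this]
  · rw [hS.avarMetaSW_eq]
    refine Finset.sum_congr rfl fun k _ => ?_
    have := (hS.rho_pos k).ne'
    field_simp

lemma Homogeneous.sum_rho_div_pos (hS : Homogeneous S P c β σ) :
    0 < ∑ k, S.rho P k / S.avarLocal P β σ k := by
  have := hS.nonempty_study
  exact Finset.sum_pos (fun k _ => div_pos (hS.rho_pos k) (hS.avarLocal_pos k))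
    Finset.univ_nonempty

/-- Meta-analysis with inverse-variance weights. -/
lemma Homogeneous.isAsymptoticVariance_tauMetaIVW (hS : Homogeneous S P c β σ) :
    IsAsymptoticVariance P (fun n _ => n)
      (fun n ω => tauMetaIVW (S.avarLocal P β σ) (S.data n ω)) (S.ate P)
      (S.avarMetaIVW P β σ) := by
  have hV := hS.sum_rho_div_pos
  set v := S.avarLocal P β σ with hv
  have hm : ∀ k n, Measurable fun ω => (v k / ((site (S.data n ω) k).card : ℝ))⁻¹ := fun k n =>
    ((hS.measurable_card_site k n).const_div (v k)).inv
  have hlim : ∀ᵐ ω ∂P, ∀ k, Tendsto (fun n : ℕ =>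
      (v k / ((site (S.data n ω) k).card : ℝ))⁻¹ / n) atTop (𝓝 (S.rho P k / v k)) := by
    filter_upwards [ae_all_iff.2 hS.tendsto_card_site] with ω hω k
    refine ((hω k).div_const (v k)).congr fun n => ?_
    -- The identity (v / n_k)⁻¹ = n_k / v holds for an empty study too: both sides are zero.
    rw [inv_div, div_right_comm]
  have hsumlim : ∀ᵐ ω ∂P, Tendsto (fun n : ℕ =>
      (∑ k, (v k / ((site (S.data n ω) k).card : ℝ))⁻¹) / n) atTop
      (𝓝 (∑ k, S.rho P k / v k)) := by
    filter_upwards [hlim] with ω hω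
    simp only [Finset.sum_div]
    exact tendsto_finsetSum _ fun k _ => hω k
  refine hS.isAsymptoticVariance_weighted
    (B := fun k n ω => (v k / ((site (S.data n ω) k).card : ℝ))⁻¹ /
      ∑ j, (v j / ((site (S.data n ω) j).card : ℝ))⁻¹)
    (b := fun k => S.rho P k / v k / ∑ j, S.rho P j / v j)
    (fun k n => (hm k n).div (Finset.measurable_sum _ fun j _ => hm j n)) (fun k => ?_) ?_
    (fun n ω => ?_) ?_
  · filter_upwards [hlim, hsumlim] with ω h1 h2
    refine ((h1 k).div h2 hV.ne').congr' ?_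
    filter_upwards [eventually_gt_atTop 0] with n hn
    have : (n : ℝ) ≠ 0 := by exact_mod_cast hn.ne'
    rw [Pi.div_apply, div_div_div_cancel_right₀ this]
  · filter_upwards [hsumlim] with ω h
    filter_upwards [h.eventually_const_lt hV] with n hn
    rw [← Finset.sum_div]
    refine div_self fun h0 => ?_
    rw [h0, zero_div] at hn
    exact lt_irrefl _ hn
  · rw [tauMetaIVW, Finset.sum_div]
    exact Finset.sum_congr rfl fun k _ => by rw [div_mul_eq_mul_div]
  -- With limiting weights proportional to ρ_k / v_k, each squared weight times v_k / ρ_k is again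
  -- proportional to ρ_k / v_k, so the sum collapses to the inverse of the total precision.
  · have h : ∀ k, (S.rho P k / v k / ∑ j, S.rho P j / v j) ^ 2 * ((S.rho P k)⁻¹ * v k) =
        S.rho P k / v k * ((∑ j, S.rho P j / v j) ^ 2)⁻¹ := by
      intro k
      have h1 := (hS.rho_pos k).ne'
      have h2 := (hS.avarLocal_pos k).ne'
      rw [← hv] at h2
      rw [div_pow, div_pow]
      field_simp
    rw [Finset.sum_congr rfl fun k _ => h k, ← Finset.sum_mul, Population.avarMetaIVW,
      ← hv, sq, mul_inv, mul_inv_cancel_left₀ hV.ne']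

lemma Homogeneous.avarLocal_ne (hS : Homogeneous S P c β σ) {j k : Fin K}
    (h : S.pStudy P j * (1 - S.pStudy P j) ≠ S.pStudy P k * (1 - S.pStudy P k)) :
    S.avarLocal P β σ j ≠ S.avarLocal P β σ k := by
  intro heq
  rw [Population.avarLocal, Population.avarLocal, add_left_inj, div_eq_mul_inv, div_eq_mul_inv,
    mul_right_inj' (pow_pos hS.sigma_pos 2).ne', inv_inj] at heq
  exact h heq

end Estimators

end

end FedCausal

/-! ### The theorem -/

open FedCausal in
theorem mainTheorem4 {K d : ℕ} {Ω : Type*} [MeasurableSpace Ω]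
    (P : MeasureTheory.Measure Ω) [MeasureTheory.IsProbabilityMeasure P]
    (S : FedCausal.Population K d Ω) (c : Fin 2 → ℝ) (β : Fin 2 → Fin d → ℝ) (σ : ℝ)
    (hS : FedCausal.Homogeneous S P c β σ) :
    -- the local estimators, whose asymptotic variances give the weights of Meta-IVW
    (∀ k : Fin K, FedCausal.IsAsymptoticVariance P
      (fun n ω => (FedCausal.site (S.data n ω) k).card)
      (fun n ω => FedCausal.tauLocal k (S.data n ω)) (S.ate P) (S.avarLocal P β σ k)) ∧
    -- the pooled estimator
    FedCausal.IsAsymptoticVariance P (fun n _ => n)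
      (fun n ω => FedCausal.tauPool (S.data n ω)) (S.ate P) (S.avarPool P β σ) ∧
    -- the federated estimators
    (∀ a : FedCausal.FedAvgRule K d, a.Tuned → FedCausal.IsAsymptoticVariance P (fun n _ => n)
      (fun n ω => FedCausal.tauGD a (S.data n ω)) (S.ate P) (S.avarPool P β σ)) ∧
    (∀ a : FedCausal.FedAvgRule K d, a.OneStep → a.Tuned) ∧
    FedCausal.IsAsymptoticVariance P (fun n _ => n)
      (fun n ω => FedCausal.tau1SIVW σ (S.data n ω)) (S.ate P) (S.avarPool P β σ) ∧
    FedCausal.IsAsymptoticVariance P (fun n _ => n)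
      (fun n ω => FedCausal.tau1SSW (S.data n ω)) (S.ate P) (S.avarPool P β σ) ∧
    -- the meta-analysis estimators
    FedCausal.IsAsymptoticVariance P (fun n _ => n)
      (fun n ω => FedCausal.tauMetaIVW (S.avarLocal P β σ) (S.data n ω)) (S.ate P)
      (S.avarMetaIVW P β σ) ∧
    FedCausal.IsAsymptoticVariance P (fun n _ => n)
      (fun n ω => FedCausal.tauMetaSW (S.data n ω)) (S.ate P) (S.avarMetaSW P β σ) ∧
    -- the comparison
    S.avarPool P β σ ≤ S.avarMetaIVW P β σ ∧
    S.avarMetaIVW P β σ ≤ S.avarMetaSW P β σ ∧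
    ((∃ j k, S.pStudy P j ≠ S.pStudy P k) → S.avarPool P β σ < S.avarMetaIVW P β σ) ∧
    ((∃ j k, S.pStudy P j * (1 - S.pStudy P j) ≠ S.pStudy P k * (1 - S.pStudy P k)) →
      S.avarMetaIVW P β σ < S.avarMetaSW P β σ) := by
  obtain ⟨hpool, hpool'⟩ := pooled_le_inv_sum_div hS.rho_pos hS.sum_rho hS.pStudy_mem
    (pow_pos hS.sigma_pos 2) hS.effectSq_nonneg hS.pTreat_eq hS.pTreat_mem
  obtain ⟨hmeta, hmeta'⟩ := inv_sum_div_le hS.rho_pos hS.sum_rho hS.avarLocal_pos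
  rw [← hS.avarMetaSW_eq] at hmeta hmeta'
  refine ⟨hS.isAsymptoticVariance_tauLocal,
    hS.isAsymptoticVariance_gFormula_univ hS.hasInfluence_thetaPool, fun a ha => ?_,
    fun a ha => ha.tuned, ?_, ?_, hS.isAsymptoticVariance_tauMetaIVW,
    hS.isAsymptoticVariance_tauMetaSW, hpool, hmeta, hpool',
    fun ⟨j, k, hjk⟩ => hmeta' ⟨j, k, hS.avarLocal_ne hjk⟩⟩
  · simp only [tauGD, swAggregate_gFormula]
    exact hS.isAsymptoticVariance_gFormula_univ (hS.hasInfluence_thetaGD ha)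
  · simp only [tau1SIVW, swAggregate_gFormula]
    exact hS.isAsymptoticVariance_gFormula_univ hS.hasInfluence_theta1SIVW
  · simp only [tau1SSW, swAggregate_gFormula]
    exact hS.isAsymptoticVariance_gFormula_univ hS.hasInfluence_theta1SSW
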